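/- Notation. $\Pi_n$ is the lattice of partitions of the set $\{1,\dots,n\}$ ordered by refinement, with rank function $n-\#\text{blocks}$; for $S\subseteq[1,n-2]$, $\Pi_n(S)$ is the subposet of elements whose rank lies in $S$. $\alpha_S(n)$ is the complex permutation representation of $S_n$ on the maximal chains of $\Pi_n(S)$, and $\beta_S(n)$ is the representation of $S_n$ on the top reduced homology $\tilde H_{|S|-1}(\Delta(\Pi_n(S));\mathbb C)$ of the order complex. For a partition $\lambda$ of $n$, the irreducible $S_n$-representation indexed by $\lambda$ is the one whose Frobenius characteristic is the Schur function $s_\lambda$; $h_r$ is the complete homogeneous symmetric function. For a representation $V$ of $S_n$ and $0\le\ell\le n$, $D_{(n-\ell)}V$ is the representation of $S_\ell$ obtained by skewing by the irreducible indexed by $(n-\ell)$, i.e. the $S_{n-\ell}$-fixed vectors of $V$, on which $S_\ell$ acts through $S_\ell\times S_{n-\ell}\subseteq S_n$; equivalently $\langle D_{(n-\ell)}V,s_\nu\rangle=\langle V,h_{n-\ell}s_\nu\rangle$ for all $\nu\vdash\ell$. Theorem. Let $S$ be a nonempty finite set of positive integers and $k\ge 0$ an integer. Let $n,n'$ be such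 that $S\subseteq[1,n-2]$, $S\subseteq[1,n'-2]$, $n\ge 2\max(S)+k$ and $n'\ge 2\max(S)+k$. (1) Let $\lambda\vdash n$ be such that $s_\lambda$ lies in the linear span of $U_k=\{h_{n-\ell}s_\mu:0\le\ell\le k,\ \mu\vdash\ell\}$, and let $\lambda'\vdash n'$ differ from $\lambda$ at most in the first (largest) part. Then the multiplicity of the irreducible indexed by $\lambda$ in $\alpha_S(n)$ equals the multiplicity of the irreducible indexed by $\lambda'$ in $\alpha_S(n')$, and likewise for $\beta_S(n)$ and $\beta_S(n')$. (2) For every $0\le\ell\le k$, $D_{(n-\ell)}\alpha_S(n)\cong D_{(n'-\ell)}\alpha_S(n')$ and $D_{(n-\ell)}\beta_S(n)\cong D_{(n'-\ell)}\beta_S(n')$ as representations of $S_\ell$. -/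

import Mathlib

open Equiv (Perm)

/-! ### Symmetric functions

Symmetric functions that are homogeneous of degree `n` are written in the `n` variables
`x_0, …, x_{n-1}`; restriction to `n` variables loses no information in degree `n`. -/

/-- The complete homogeneous symmetric polynomial `h_r` for an integer `r`, with `h_r = 0`
for `r < 0`. -/
noncomputable def hInt (σ : Type) [Fintype σ] [DecidableEq σ] (r : ℤ) : MvPolynomial σ ℂ :=
  if 0 ≤ r then MvPolynomial.hsymm σ ℂ r.toNat else 0

/-- The parts of an integer partition, listed in weakly decreasing order. -/
def rowLengths {n : ℕ} (lam : n.Partition) : List ℕ :=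
  lam.parts.sort (· ≥ ·)

/-- The Schur function `s_λ = det (h_{λ_i - i + j})`. -/
noncomputable def schur (σ : Type) [Fintype σ] [DecidableEq σ] {n : ℕ} (lam : n.Partition) :
    MvPolynomial σ ℂ :=
  Matrix.det (Matrix.of fun i j : Fin (rowLengths lam).length =>
    hInt σ (((rowLengths lam).get i : ℤ) - (i : ℤ) + (j : ℤ)))

/-- The set `U_k = {h_{n-ℓ} s_μ : 0 ≤ ℓ ≤ k, μ ⊢ ℓ}` of symmetric functions of degree `n`. -/
def stableSet (n k : ℕ) : Set (MvPolynomial (Fin n) ℂ) :=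
  {f | ∃ l : ℕ, l ≤ k ∧ ∃ mu : l.Partition,
    f = hInt (Fin n) ((n : ℤ) - (l : ℤ)) * schur (Fin n) mu}

/-- The Frobenius characteristic `ch V = (1/n!) ∑_g χ_V(g) p_{cyc(g)}` of a representation of
the symmetric group, where `cyc(g)` is the cycle type of `g` including fixed points. -/
noncomputable def frobeniusChar {n : ℕ} {V : Type*} [AddCommGroup V] [Module ℂ V]
    (ρ : Representation ℂ (Perm (Fin n)) V) : MvPolynomial (Fin n) ℂ :=
  ((n.factorial : ℂ)⁻¹) • ∑ g : Perm (Fin n),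
    ρ.character g • MvPolynomial.psumPart (Fin n) ℂ g.partition

/-- `ρ` is the irreducible representation of the symmetric group indexed by the partition `λ`:
it is irreducible and its Frobenius characteristic is the Schur function `s_λ`. -/
def IsIrreducibleIndexedBy {n : ℕ} {V : Type*} [AddCommGroup V] [Module ℂ V]
    (ρ : Representation ℂ (Perm (Fin n)) V) (lam : n.Partition) : Prop :=
  ρ.IsIrreducible ∧ frobeniusChar ρ = schur (Fin n) lam

/-- The multiplicity of an irreducible complex representation `ρ` in a representation `τ`,
namely `dim Hom_G(ρ, τ)`. -/
noncomputable def irrMultiplicity {G V W : Type*} [Group G] [AddCommGroup V] [Module ℂ V]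
    [AddCommGroup W] [Module ℂ W] (ρ : Representation ℂ G V) (τ : Representation ℂ G W) : ℕ :=
  Module.finrank ℂ (ρ.IntertwiningMap τ)

/-! ### Skewing -/

/-- The Young subgroup inclusion `S_l × S_m → S_{l+m}`: the first factor permutes the first `l`
points, the second one the last `m` points. -/
def youngHom (l m : ℕ) : Perm (Fin l) × Perm (Fin m) →* Perm (Fin (l + m)) where
  toFun p := finSumFinEquiv.permCongr (Equiv.sumCongr p.1 p.2)
  map_one' := by ext x; simp
  map_mul' p q := by
    ext x
    obtain ⟨y, rfl⟩ := finSumFinEquiv.surjective x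
    cases y <;> simp

/-- The vectors fixed by the subgroup `S_m` of `S_{l+m}`. -/
noncomputable def skewSpace {l m : ℕ} {V : Type*} [AddCommGroup V] [Module ℂ V]
    (ρ : Representation ℂ (Perm (Fin (l + m))) V) : Submodule ℂ V :=
  Representation.invariants (ρ.comp ((youngHom l m).comp (MonoidHom.inr _ _)))

/-- The operation `D_{(m)}` of skewing a representation of `S_{l+m}` by the irreducible indexed
by the one-row partition `(m)` (the trivial representation of `S_m`): the representation of `S_l`
on `Hom_{S_m}(1, V)`, that is, on the `S_m`-fixed vectors. By Frobenius reciprocity it satisfies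
`⟨D_{(m)} V, s_ν⟩ = ⟨V, h_m s_ν⟩` for all `ν ⊢ l`. -/
noncomputable def skewRow {l m : ℕ} {V : Type*} [AddCommGroup V] [Module ℂ V]
    (ρ : Representation ℂ (Perm (Fin (l + m))) V) :
    Representation ℂ (Perm (Fin l)) (skewSpace ρ) :=
  Representation.subrepresentation (ρ.comp ((youngHom l m).comp (MonoidHom.inl _ _)))
    (skewSpace ρ) (by
      intro g v hv h
      have hv' := hv h
      simp only [MonoidHom.comp_apply, MonoidHom.inl_apply, MonoidHom.inr_apply] at hv' ⊢
      rw [← Module.End.mul_apply, ← map_mul, ← map_mul]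
      conv_rhs => rw [← hv']
      rw [← Module.End.mul_apply, ← map_mul, ← map_mul]
      simp)

/-! ### Reduced homology of the order complex of a poset -/

section OrderComplex

variable (P : Type) [PartialOrder P]

/-- The action of an automorphism of `P` on the chains `x_0 < x_1 < ⋯ < x_{j-1}` of `P`. -/
def moveChain {P : Type} [PartialOrder P] {j : ℕ} (e : P ≃o P) (c : Fin j ↪o P) : Fin j ↪o P :=
  c.trans e.toOrderEmbedding

/-- The space of formal complex combinations of the `j`-element chains of `P`. -/
def Chains (j : ℕ) : Type :=
  (Fin j ↪o P) →₀ ℂ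

noncomputable instance (j : ℕ) : AddCommGroup (Chains P j) :=
  inferInstanceAs (AddCommGroup ((Fin j ↪o P) →₀ ℂ))

noncomputable instance (j : ℕ) : Module ℂ (Chains P j) :=
  inferInstanceAs (Module ℂ ((Fin j ↪o P) →₀ ℂ))

/-- The representation of the automorphism group of `P` on the space spanned by the
`j`-element chains of `P`, which are the simplices of dimension `j - 1` of the order complex.
For `j = 0` this is spanned by the empty simplex. -/
noncomputable def chainRep (j : ℕ) :
    Representation ℂ (P ≃o P) (Chains P j) where
  toFun e := Finsupp.lmapDomain ℂ ℂ (moveChain e)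
  map_one' := Finsupp.lmapDomain_id ℂ ℂ
  map_mul' e f := Finsupp.lmapDomain_comp ℂ ℂ (moveChain f) (moveChain e)

/-- The boundary map `∂ (x_0 < ⋯ < x_j) = ∑_i (-1)^i (x_0 < ⋯ < x̂_i < ⋯ < x_j)` of the
augmented chain complex. -/
noncomputable def boundary (j : ℕ) : Chains P (j + 1) →ₗ[ℂ] Chains P j :=
  Finsupp.linearCombination ℂ fun c =>
    ∑ i : Fin (j + 1), Finsupp.single ((Fin.succAboveOrderEmb i).trans c) ((-1 : ℂ) ^ (i : ℕ))

theorem boundary_chainRep (j : ℕ) (e : P ≃o P) (v : Chains P (j + 1)) :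
    boundary P j (chainRep P (j + 1) e v) = chainRep P j e (boundary P j v) := by
  let F : ((Fin (j + 1) ↪o P) →₀ ℂ) →ₗ[ℂ] ((Fin j ↪o P) →₀ ℂ) :=
    Finsupp.linearCombination ℂ fun c =>
      ∑ i : Fin (j + 1), Finsupp.single ((Fin.succAboveOrderEmb i).trans c) ((-1 : ℂ) ^ (i : ℕ))
  have h : F ∘ₗ Finsupp.lmapDomain ℂ ℂ (moveChain e) =
      Finsupp.lmapDomain ℂ ℂ (moveChain e) ∘ₗ F := by
    refine Finsupp.lhom_ext fun c a => ?_
    simp only [F, LinearMap.comp_apply,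
      Finsupp.lmapDomain_apply, Finsupp.mapDomain_single, Finsupp.linearCombination_single,
      Finsupp.mapDomain_smul, Finsupp.mapDomain_finsetSum]
    rfl
  exact LinearMap.congr_fun h v

/-- The cycles of dimension `j - 1` of the augmented chain complex of the order complex. -/
noncomputable def cycles : (j : ℕ) → Submodule ℂ (Chains P j)
  | 0 => ⊤
  | j + 1 => LinearMap.ker (boundary P j)

theorem cycles_le (j : ℕ) (e : P ≃o P) : cycles P j ≤ (cycles P j).comap (chainRep P j e) := by
  cases j with
  | zero => exact fun _ _ => trivial
  | succ j =>
    intro v hv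
    have hv' : boundary P j v = 0 := hv
    change boundary P j (chainRep P (j + 1) e v) = 0
    rw [boundary_chainRep, hv', map_zero]

/-- The action of the automorphism group on cycles. -/
noncomputable def cyclesRep (j : ℕ) : Representation ℂ (P ≃o P) (cycles P j) :=
  (chainRep P j).subrepresentation (cycles P j) (cycles_le P j)

/-- The boundaries of dimension `j - 1`, as a subspace of the cycles. -/
noncomputable def boundaries (j : ℕ) : Submodule ℂ (cycles P j) :=
  (LinearMap.range (boundary P j)).comap (cycles P j).subtype

theorem boundaries_le (j : ℕ) (e : P ≃o P) :
    boundaries P j ≤ (boundaries P j).comap (cyclesRep P j e) := by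
  rintro v ⟨w, hw⟩
  refine ⟨chainRep P (j + 1) e w, ?_⟩
  rw [boundary_chainRep, hw]
  rfl

/-- The representation of the automorphism group of the poset `P` on the reduced homology
`H̃_{j-1}(Δ(P); ℂ)` of its order complex. -/
noncomputable def homologyRep (j : ℕ) :
    Representation ℂ (P ≃o P) (cycles P j ⧸ boundaries P j) :=
  (cyclesRep P j).quotient (boundaries P j) (boundaries_le P j)

end OrderComplex

/-! ### The rank-selected partition lattice

A partition of the set `Fin n` is an equivalence relation `Setoid (Fin n)`; in the order of
`Setoid (Fin n)`, `π ≤ τ` means that `π` refines `τ`. -/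

/-- The rank of a set partition in the partition lattice `Π_n`: `n` minus its number of blocks. -/
noncomputable def partitionRank {n : ℕ} (π : Setoid (Fin n)) : ℕ :=
  n - Nat.card (Quotient π)

/-- The rank-selected subposet `Π_n(S)` of the partition lattice. -/
abbrev RankSelected (n : ℕ) (S : Finset ℕ) : Type :=
  {π : Setoid (Fin n) // partitionRank π ∈ S}

/-- The image of a set partition under a permutation: `i` and `j` are in the same block of `g π`
if and only if `g⁻¹ i` and `g⁻¹ j` are in the same block of `π`. -/
def permutePartition {n : ℕ} (g : Perm (Fin n)) (π : Setoid (Fin n)) : Setoid (Fin n) :=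
  π.comap (g⁻¹ : Perm (Fin n))

theorem partitionRank_permutePartition {n : ℕ} (g : Perm (Fin n)) (π : Setoid (Fin n)) :
    partitionRank (permutePartition g π) = partitionRank π := by
  unfold partitionRank
  congr 1
  exact Nat.card_congr (Quotient.congr (g⁻¹ : Perm (Fin n)) fun a b => Iff.rfl)

theorem permutePartition_inv {n : ℕ} (g : Perm (Fin n)) (π : Setoid (Fin n)) :
    permutePartition g⁻¹ (permutePartition g π) = π := by
  refine Setoid.ext fun a b => ?_
  change π (g⁻¹ (g⁻¹⁻¹ a)) (g⁻¹ (g⁻¹⁻¹ b)) ↔ π a b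
  simp

/-- The action of the symmetric group `S_n` on `Π_n(S)` by poset automorphisms. -/
def permAut (n : ℕ) (S : Finset ℕ) :
    Perm (Fin n) →* (RankSelected n S ≃o RankSelected n S) where
  toFun g :=
    { toFun := fun π => ⟨permutePartition g π.1, by
        rw [partitionRank_permutePartition]; exact π.2⟩
      invFun := fun π => ⟨permutePartition g⁻¹ π.1, by
        rw [partitionRank_permutePartition]; exact π.2⟩
      left_inv := fun π => Subtype.ext (permutePartition_inv g π.1)
      right_inv := fun π => Subtype.ext (by
        have h := permutePartition_inv g⁻¹ π.1
        rwa [inv_inv] at h)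
      map_rel_iff' := by
        intro π τ
        constructor
        · intro h a b hab
          have h' : π.1 (g⁻¹ (g a)) (g⁻¹ (g b)) → τ.1 (g⁻¹ (g a)) (g⁻¹ (g b)) := @h (g a) (g b)
          simp only [← Perm.mul_apply, inv_mul_cancel, Perm.one_apply] at h'
          exact h' hab
        · intro h a b hab
          exact h hab }
  map_one' := rfl
  map_mul' g h := by
    refine OrderIso.ext (funext fun π => Subtype.ext (Setoid.ext fun a b => ?_))
    change π.1 ((g * h)⁻¹ a) ((g * h)⁻¹ b) ↔ π.1 (h⁻¹ (g⁻¹ a)) (h⁻¹ (g⁻¹ b))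
    rw [mul_inv_rev]
    rfl

/-- The permutation representation `α_S(n)` of `S_n` on the maximal chains of `Π_n(S)`. -/
noncomputable def alphaRep (n : ℕ) (S : Finset ℕ) :
    Representation ℂ (Perm (Fin n)) (MonoidAlgebra ℂ (Flag (RankSelected n S))) :=
  (Representation.ofMulAction ℂ (RankSelected n S ≃o RankSelected n S)
    (Flag (RankSelected n S))).comp (permAut n S)

/-- The representation `β_S(n)` of `S_n` on the (top) reduced homology
`H̃_{|S|-1}(Δ(Π_n(S)); ℂ)` of the rank-selected partition lattice. -/
noncomputable def betaRep (n : ℕ) (S : Finset ℕ) :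
    Representation ℂ (Perm (Fin n))
      (cycles (RankSelected n S) S.card ⧸ boundaries (RankSelected n S) S.card) :=
  (homologyRep (RankSelected n S) S.card).comp (permAut n S)

/-! Stability comes from small supports. Write M for max S. A set partition of rank at most M has at
most 2M points in non-singleton blocks (`card_partitionSupport_le`), and the support of a chain is
that of its top element. Adding singleton blocks embeds chains on l + m points into chains on l + m'
points, for m ≤ m'. Once 2M ≤ m, every chain on l + m' points can be moved by S_{m'} into the image,
and two chains whose images are S_{m'}-conjugate are already S_m-conjugate. So the embedding induces
a bijection between S_m-orbits and S_{m'}-orbits (`exists_moveChain_eq_of_extend`,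
`exists_moveChain_extend_eq`).

Extending by singletons and then summing over S_{m'} gives `stabMap`. It commutes with S_l and with
the boundary, and restricts to an isomorphism from S_m-invariant to S_{m'}-invariant chains. Hence
it also matches invariant cycles. The maximal chains of Π_n(S) are the chains with |S| elements, and
the top homology is the top cycle space, as there are no longer chains. This yields part (2),
because n - ℓ ≥ n - k ≥ 2M.

For part (1), s_λ in the span of U_k forces λ_1 ≥ n - k. Indeed h_1, …, h_n in n variables take
arbitrary values, so if λ_1 < n - k there is a point where h_r vanishes for n - k ≤ r ≤ n, killing
U_k, while the Jacobi–Trudi determinant survives (`exists_eval_jacobiTrudi_ne_zero`).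

A class function is determined by its Frobenius characteristic (`eq_zero_of_frobeniusFun`), and
products of h's are the characteristics of permutation representations on words. So the irreducible
character is the signed sum of word characters given by Jacobi–Trudi. In each term the first index
is λ_1 + π(0) ≥ n - k, and pairing with such a word character is a pairing on the representation
skewed by that long row (`sum_wordChar_cons_mul_character`). The remaining indices depend only on
the tail of λ, so part (1) reduces to the stability of skewed representations. -/

/-! ### Transfer of invariants -/

section Transfer

variable {k G H V W X Y : Type*} [Field k] [CharZero k] [Group G] [Fintype G] [Group H] [Fintype H]
  [AddCommGroup V] [Module k V] [AddCommGroup W] [Module k W]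

omit [Fintype G] in
/-- For a linear map `F` between permutation modules that comes from an injection of the permuted
sets inducing a bijection on orbits, `norm ∘ F` is injective on invariants. -/
theorem norm_comp_injOn_invariants [Fintype X] (ρ : Representation k G V) (σ : Representation k H W)
    (bV : Module.Basis X k V) (bW : Module.Basis Y k W) (actV : G → X → X) (actW : H → Y → Y)
    (hV : ∀ g x, ρ g (bV x) = bV (actV g x)) (hW : ∀ h y, σ h (bW y) = bW (actW h y))
    (F : V →ₗ[k] W) (f : X → Y) (hF : ∀ x, F (bV x) = bW (f x))
    (hinj : ∀ x₁ x₂ h, actW h (f x₁) = f x₂ → ∃ g, actV g x₁ = x₂)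
    {v : V} (hv : v ∈ ρ.invariants) (h0 : σ.norm (F v) = 0) : v = 0 := by
  classical
  have hinv : ∀ g x, bV.repr v (actV g x) = bV.repr v x := by
    intro g x
    have hperm : ∀ u : V, bV.repr (ρ g u) (actV g x) = bV.repr u x := by
      have hinj' : ∀ x', actV g x' = actV g x ↔ x' = x := by
        refine fun x' => ⟨fun h => ?_, fun h => h ▸ rfl⟩
        apply bV.injective
        have := congrArg bV h
        rw [← hV, ← hV] at this
        exact (ρ.apply_bijective g).1 this
      intro u
      refine LinearMap.congr_fun (f := Finsupp.lapply (actV g x) ∘ₗ bV.repr.toLinearMap ∘ₗ ρ g)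
        (g := Finsupp.lapply x ∘ₗ bV.repr.toLinearMap) (bV.ext fun i => ?_) u
      simp [hV, Finsupp.single_apply, hinj']
    have := hperm v
    rwa [hv g] at this
  have hFv : F v = ∑ x, bV.repr v x • bW (f x) := by
    conv_lhs => rw [← bV.sum_repr v]
    rw [map_sum]
    simp only [map_smul, hF]
  refine bV.ext_elem fun x => ?_
  -- By `hinj`, only points in the orbit of `x` contribute to this coefficient, and all of them
  -- carry the coefficient of `x`. The factor counting them is positive, hence nonzero in
  -- characteristic zero.
  have key : bW.repr (σ.norm (F v)) (f x) =
      bV.repr v x * ((Finset.univ.filter fun p : H × X => actW p.1 (f p.2) = f x).card : k) := by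
    rw [hFv, Finset.card_filter]
    simp only [Representation.norm, LinearMap.sum_apply, map_sum, map_smul, hW, Finsupp.coe_finsetSum,
      Finset.sum_apply, Module.Basis.repr_self, Finsupp.smul_apply, smul_eq_mul,
      Finsupp.single_apply]
    rw [Nat.cast_sum, Finset.mul_sum, Fintype.sum_prod_type,
      Finset.sum_comm]
    refine Finset.sum_congr rfl fun x' _ => ?_
    rw [Finset.mul_sum]
    refine Finset.sum_congr rfl fun h _ => ?_
    by_cases hx : actW h (f x') = f x
    · obtain ⟨g, rfl⟩ := hinj _ _ _ hx
      simp [hx, hinv]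
    · simp [hx]
  rw [h0] at key
  have hone : actW 1 (f x) = f x := bW.injective (by rw [← hW]; simp)
  have hcard : (Finset.univ.filter fun p : H × X => actW p.1 (f p.2) = f x).card ≠ 0 :=
    Finset.card_ne_zero_of_mem (a := (1, x)) (by simp [hone])
  simpa [hcard] using key.symm

/-- For a linear map `F` between permutation modules that comes from an injection of the permuted
sets inducing a surjection on orbits, `norm ∘ F` is surjective on invariants. -/
theorem norm_comp_surjOn_invariants (ρ : Representation k G V) (σ : Representation k H W)
    (bV : Module.Basis X k V) (bW : Module.Basis Y k W) (actW : H → Y → Y)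
    (hW : ∀ h y, σ h (bW y) = bW (actW h y))
    (F : V →ₗ[k] W) (f : X → Y) (hF : ∀ x, F (bV x) = bW (f x))
    (hsurj : ∀ y, ∃ h x, actW h (f x) = y)
    (hext : ∀ g, ∃ h, ∀ v, σ h (F v) = F (ρ g v))
    {w : W} (hw : w ∈ σ.invariants) : ∃ v ∈ ρ.invariants, σ.norm (F v) = w := by
  let R : Submodule k W := ρ.invariants.map (σ.norm ∘ₗ F)
  have hG : (Fintype.card G : k) ≠ 0 := by simp
  have hH : (Fintype.card H : k) ≠ 0 := by simp
  -- Averaging `v` over `G` does not change `σ.norm (F v)`: each `g` is realised on the image of `F`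
  -- by some `h`, which the norm absorbs.
  have hFR : ∀ v, σ.norm (F v) ∈ R := by
    intro v
    refine ⟨(Fintype.card G : k)⁻¹ • ρ.norm v, ?_, ?_⟩
    · exact Submodule.smul_mem _ _ fun g => ρ.self_norm_apply g v
    · have : σ.norm (F (ρ.norm v)) = (Fintype.card G : k) • σ.norm (F v) := by
        have hg : ∀ g, σ.norm (F (ρ g v)) = σ.norm (F v) := fun g => by
          obtain ⟨h, hh⟩ := hext g
          rw [← hh, σ.norm_self_apply]
        have hn : ρ.norm v = ∑ g, ρ g v := LinearMap.sum_apply _ _ _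
        rw [hn, map_sum, map_sum, Finset.sum_congr rfl fun g _ => hg g]
        simp [Nat.cast_smul_eq_nsmul]
      simp [this, hG]
  have hR : ∀ u, σ.norm u ∈ R := by
    intro u
    have hle : Submodule.span k (Set.range bW) ≤ R.comap σ.norm := by
      rw [Submodule.span_le]
      rintro _ ⟨y, rfl⟩
      obtain ⟨h, x, rfl⟩ := hsurj y
      rw [SetLike.mem_coe, Submodule.mem_comap, ← hW, σ.norm_self_apply, ← hF]
      exact hFR _
    exact hle (bW.mem_span u)
  have hwR : w ∈ R := by
    have : w = (Fintype.card H : k)⁻¹ • σ.norm w := by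
      have : σ.norm w = (Fintype.card H : k) • w := by
        rw [Representation.norm, LinearMap.sum_apply, Finset.sum_congr rfl fun h _ => hw h]
        simp [Nat.cast_smul_eq_nsmul]
      rw [this, smul_smul, inv_mul_cancel₀ hH, one_smul]
    rw [this]
    exact R.smul_mem _ (hR w)
  obtain ⟨v, hv, h⟩ := hwR
  exact ⟨v, hv, h⟩

end Transfer

/-! ### Functoriality of skewing -/

section Skew

variable {l m m' : ℕ} {V W : Type*} [AddCommGroup V] [Module ℂ V] [AddCommGroup W] [Module ℂ W]

/-- A linear map that commutes with `S_l` and restricts to a bijection between the fixed vectors of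
`S_m` and those of `S_{m'}` induces an isomorphism of the skewed representations. -/
theorem nonempty_skewRow_equiv (ρ : Representation ℂ (Perm (Fin (l + m))) V)
    (σ : Representation ℂ (Perm (Fin (l + m'))) W) (T : V →ₗ[ℂ] W)
    (hT : ∀ (g : Perm (Fin l)) v, T (ρ (youngHom l m (g, 1)) v) = σ (youngHom l m' (g, 1)) (T v))
    (hmem : ∀ v ∈ skewSpace ρ, T v ∈ skewSpace σ)
    (hinj : ∀ v ∈ skewSpace ρ, T v = 0 → v = 0)
    (hsurj : ∀ w ∈ skewSpace σ, ∃ v ∈ skewSpace ρ, T v = w) :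
    Nonempty ((skewRow ρ).Equiv (skewRow σ)) := by
  refine ⟨Representation.Equiv.mk (LinearEquiv.ofBijective (T.restrict hmem) ⟨?_, ?_⟩) ?_⟩
  · rw [← LinearMap.ker_eq_bot, LinearMap.ker_eq_bot']
    exact fun v hv => Subtype.ext (hinj v v.2 (congrArg Subtype.val hv))
  · rintro ⟨w, hw⟩
    obtain ⟨v, hv, h⟩ := hsurj w hw
    exact ⟨⟨v, hv⟩, Subtype.ext h⟩
  · intro g
    ext v
    exact hT g v

theorem Representation.Equiv.nonempty_skewRow {ρ : Representation ℂ (Perm (Fin (l + m))) V}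
    {σ : Representation ℂ (Perm (Fin (l + m))) W} (e : ρ.Equiv σ) :
    Nonempty ((skewRow ρ).Equiv (skewRow σ)) := by
  have he : ∀ g v, e (ρ g v) = σ g (e v) := 
    IntertwiningMap.isIntertwining ρ σ e.toIntertwiningMap
  refine nonempty_skewRow_equiv ρ σ e.toLinearEquiv.toLinearMap (fun g v => he _ v) ?_ ?_ ?_
  · intro v hv g
    exact (he _ v).symm.trans (congrArg e (hv g))
  · intro v _ h
    exact e.toLinearEquiv.map_eq_zero_iff.1 h
  · intro w hw
    refine ⟨e.symm w, fun g => ?_, e.apply_symm_apply w⟩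
    apply e.toLinearEquiv.injective
    change e (ρ _ (e.symm w)) = e (e.symm w)
    rw [he, e.apply_symm_apply]
    exact hw g

end Skew

/-! ### Supports and extensions of set partitions -/

section Partitions

variable {n n' : ℕ}

theorem card_quotient_le (π : Setoid (Fin n)) : Nat.card (Quotient π) ≤ n := by
  simpa using Nat.card_le_card_of_surjective (Quotient.mk π) Quotient.mk_surjective

open Classical in
/-- The points lying in blocks of size at least two. -/
noncomputable def partitionSupport (π : Setoid (Fin n)) : Finset (Fin n) :=
  Finset.univ.filter fun a => ∃ b, b ≠ a ∧ π a b

theorem mem_partitionSupport {π : Setoid (Fin n)} {a : Fin n} :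
    a ∈ partitionSupport π ↔ ∃ b, b ≠ a ∧ π a b := by
  simp [partitionSupport]

/-- Choose a representative in each block. The non-representatives number exactly the rank, and each
point of the support is a non-representative or the representative of one. -/
theorem card_partitionSupport_le (π : Setoid (Fin n)) :
    (partitionSupport π).card ≤ 2 * partitionRank π := by
  classical
  let r : Fin n → Fin n := fun a => (Quotient.mk π a).out
  have hr : ∀ a, π (r a) a := fun a => Quotient.mk_out a
  have hr' : ∀ a b, π a b → r a = r b := fun a b h => congrArg Quotient.out (Quotient.sound h)
  let N : Finset (Fin n) := Finset.univ.filter fun a => r a ≠ a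
  have hN : N.card = partitionRank π := by
    have h1 : (Finset.univ.filter fun a => r a = a).card = Nat.card (Quotient π) := by
      rw [Nat.card_eq_fintype_card, ← Finset.card_univ,
        ← Finset.card_image_of_injective _ (Quotient.out_injective (s := π))]
      congr 1
      ext a
      simp only [Finset.mem_filter, Finset.mem_univ, true_and, Finset.mem_image]
      refine ⟨fun h => ⟨_, h⟩, ?_⟩
      rintro ⟨q, rfl⟩
      simp [r]
    have h2 := Finset.card_filter_add_card_filter_not (s := Finset.univ) (fun a => r a = a)
    rw [h1, Finset.card_univ, Fintype.card_fin] at h2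
    unfold partitionRank
    simp only [N, ne_eq]
    omega
  have hsub : partitionSupport π ⊆ N ∪ N.image r := by
    intro a ha
    obtain ⟨b, hb, hab⟩ := mem_partitionSupport.1 ha
    by_cases h : r a = a
    · refine Finset.mem_union_right _ (Finset.mem_image.2 ⟨b, ?_, ?_⟩)
      · simp only [N, Finset.mem_filter, Finset.mem_univ, true_and]
        rw [← hr' a b hab, h]
        exact hb.symm
      · rw [← hr' a b hab, h]
    · exact Finset.mem_union_left _ (by simpa [N] using h)
  calc (partitionSupport π).card ≤ (N ∪ N.image r).card := Finset.card_le_card hsub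
    _ ≤ N.card + (N.image r).card := Finset.card_union_le _ _
    _ ≤ N.card + N.card := Nat.add_le_add_left Finset.card_image_le _
    _ = 2 * partitionRank π := by rw [hN, two_mul]

/-- The image of a set partition under an injection, completed by singleton blocks. -/
def extendPartition (e : Fin n ↪ Fin n') (π : Setoid (Fin n)) : Setoid (Fin n') where
  r a b := a = b ∨ ∃ x y, e x = a ∧ e y = b ∧ π x y
  iseqv :=
    { refl := fun _ => Or.inl rfl
      symm := by
        rintro a b (rfl | ⟨x, y, rfl, rfl, h⟩)
        · exact Or.inl rfl
        · exact Or.inr ⟨y, x, rfl, rfl, π.symm h⟩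
      trans := by
        rintro a b c (rfl | ⟨x, y, rfl, rfl, h⟩) (rfl | ⟨z, w, hz, rfl, h'⟩)
        · exact Or.inl rfl
        · exact Or.inr ⟨z, w, hz, rfl, h'⟩
        · exact Or.inr ⟨x, y, rfl, rfl, h⟩
        · rw [e.injective hz] at h'
          exact Or.inr ⟨x, w, rfl, rfl, π.trans h h'⟩ }

theorem extendPartition_iff {e : Fin n ↪ Fin n'} {π : Setoid (Fin n)} {a b : Fin n'} :
    extendPartition e π a b ↔ a = b ∨ ∃ x y, e x = a ∧ e y = b ∧ π x y :=
  Iff.rfl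

theorem extendPartition_apply {e : Fin n ↪ Fin n'} {π : Setoid (Fin n)} {x y : Fin n} :
    extendPartition e π (e x) (e y) ↔ π x y := by
  rw [extendPartition_iff]
  constructor
  · rintro (h | ⟨z, w, hz, hw, h⟩)
    · rw [e.injective h]
    · rwa [← e.injective hz, ← e.injective hw]
  · exact fun h => Or.inr ⟨x, y, rfl, rfl, h⟩

theorem extendPartition_le_iff {e : Fin n ↪ Fin n'} {π τ : Setoid (Fin n)} :
    extendPartition e π ≤ extendPartition e τ ↔ π ≤ τ := by
  constructor
  · intro h x y hxy
    exact extendPartition_apply.1 (h (extendPartition_apply.2 hxy))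
  · rintro h a b (rfl | ⟨x, y, rfl, rfl, hxy⟩)
    · exact Or.inl rfl
    · exact Or.inr ⟨x, y, rfl, rfl, h hxy⟩

/-- Each of the n' - n new points adds exactly one block, so the number of points minus the number
of blocks does not change. -/
theorem partitionRank_extendPartition (e : Fin n ↪ Fin n') (π : Setoid (Fin n)) :
    partitionRank (extendPartition e π) = partitionRank π := by
  let f : Quotient π ⊕ {b // b ∉ Set.range e} → Quotient (extendPartition e π) :=
    Sum.elim (Quotient.map e fun _ _ h => extendPartition_apply.2 h) fun b => Quotient.mk _ b.1
  have hf : Function.Bijective f := by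
    constructor
    · rintro (q | ⟨b, hb⟩) (q' | ⟨b', hb'⟩) h
      · induction q using Quotient.inductionOn
        induction q' using Quotient.inductionOn
        exact congrArg Sum.inl (Quotient.sound (extendPartition_apply.1 (Quotient.exact h)))
      · induction q using Quotient.inductionOn
        rcases (Quotient.exact h : extendPartition e π _ _) with h | ⟨x, y, -, rfl, -⟩
        · exact absurd ⟨_, h⟩ hb'
        · exact absurd ⟨_, rfl⟩ hb'
      · induction q' using Quotient.inductionOn
        rcases (Quotient.exact h : extendPartition e π _ _) with h | ⟨x, y, rfl, -, -⟩
        · exact absurd ⟨_, h.symm⟩ hb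
        · exact absurd ⟨_, rfl⟩ hb
      · rcases (Quotient.exact h : extendPartition e π _ _) with h | ⟨x, y, rfl, -, -⟩
        · exact congrArg Sum.inr (Subtype.ext h)
        · exact absurd ⟨_, rfl⟩ hb
    · intro q
      induction q using Quotient.inductionOn with
      | h b =>
        by_cases hb : b ∈ Set.range e
        · obtain ⟨x, rfl⟩ := hb
          exact ⟨Sum.inl (Quotient.mk _ x), rfl⟩
        · exact ⟨Sum.inr ⟨b, hb⟩, rfl⟩
  have hcard := Nat.card_eq_of_bijective f hf
  have hcompl : Nat.card {b // b ∉ Set.range e} = n' - n := by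
    classical
    rw [Nat.card_eq_fintype_card, Fintype.card_subtype_compl, Fintype.card_fin]
    congr 1
    rw [← Fintype.card_congr (Equiv.ofInjective e e.injective), Fintype.card_fin]
  rw [Nat.card_sum, hcompl] at hcard
  have h1 := card_quotient_le π
  have h2 : n ≤ n' := by simpa using Fintype.card_le_of_embedding e
  unfold partitionRank
  omega

theorem extendPartition_comap {e : Fin n ↪ Fin n'} {τ : Setoid (Fin n')}
    (h : ∀ a ∈ partitionSupport τ, a ∈ Set.range e) : extendPartition e (τ.comap e) = τ := by
  refine Setoid.ext fun a b => ?_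
  rw [extendPartition_iff]
  constructor
  · rintro (rfl | ⟨x, y, rfl, rfl, hxy⟩)
    · exact τ.refl a
    · exact hxy
  · intro hab
    by_cases hne : a = b
    · exact Or.inl hne
    · obtain ⟨x, rfl⟩ := h a (mem_partitionSupport.2 ⟨b, Ne.symm hne, hab⟩)
      obtain ⟨y, rfl⟩ := h b (mem_partitionSupport.2 ⟨_, hne, τ.symm hab⟩)
      exact Or.inr ⟨x, y, rfl, rfl, hab⟩

theorem permutePartition_apply {g : Perm (Fin n)} {π : Setoid (Fin n)} {a b : Fin n} :
    permutePartition g π (g a) (g b) ↔ π a b := by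
  change π (g⁻¹ (g a)) (g⁻¹ (g b)) ↔ _
  simp

theorem eq_permutePartition_iff {g : Perm (Fin n)} {π τ : Setoid (Fin n)} :
    permutePartition g π = τ ↔ ∀ a b, π a b ↔ τ (g a) (g b) := by
  constructor
  · rintro rfl a b
    exact permutePartition_apply.symm
  · intro h
    refine Setoid.ext fun a b => ?_
    have := h (g.symm a) (g.symm b)
    rwa [g.apply_symm_apply, g.apply_symm_apply] at this

/-- A permutation `g'` of the larger set extends a permutation `g` of the smaller one. -/
theorem extendPartition_permutePartition {e : Fin n ↪ Fin n'} {g : Perm (Fin n)}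
    {g' : Perm (Fin n')} (h : ∀ x, g' (e x) = e (g x)) (π : Setoid (Fin n)) :
    permutePartition g' (extendPartition e π) = extendPartition e (permutePartition g π) := by
  rw [eq_permutePartition_iff]
  intro a b
  have hr : ∀ x a, e x = g' a → e (g⁻¹ x) = a := by
    intro x a hx
    apply g'.injective
    rw [h, ← hx]
    simp
  simp only [extendPartition_iff]
  constructor
  · rintro (rfl | ⟨x, y, rfl, rfl, hxy⟩)
    · exact Or.inl rfl
    · exact Or.inr ⟨g x, g y, (h x).symm, (h y).symm, permutePartition_apply.2 hxy⟩
  · rintro (hab | ⟨x, y, hx, hy, hxy⟩)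
    · exact Or.inl (g'.injective hab)
    · exact Or.inr ⟨g⁻¹ x, g⁻¹ y, hr _ _ hx, hr _ _ hy, hxy⟩

end Partitions

/-! ### Chains of set partitions under stabilization -/

section ChainStability

variable {n n' : ℕ}

theorem partitionSupport_mono {π τ : Setoid (Fin n)} (h : π ≤ τ) :
    partitionSupport π ⊆ partitionSupport τ := by
  intro a ha
  obtain ⟨b, hb, hab⟩ := mem_partitionSupport.1 ha
  exact mem_partitionSupport.2 ⟨b, hb, h hab⟩

theorem mem_partitionSupport_permutePartition {g : Perm (Fin n)} {π : Setoid (Fin n)} {a : Fin n}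
    (h : a ∈ partitionSupport (permutePartition g π)) : g⁻¹ a ∈ partitionSupport π := by
  obtain ⟨b, hb, hab⟩ := mem_partitionSupport.1 h
  exact mem_partitionSupport.2 ⟨g⁻¹ b, fun h => hb (g⁻¹.injective h), hab⟩

/-- Agreement on the support suffices: every nontrivial relation, on either side, comes from two
distinct related points of `π`, and these lie in the support. -/
theorem permutePartition_eq_of_extendPartition {e : Fin n ↪ Fin n'} {g : Perm (Fin n)}
    {g' : Perm (Fin n')} {π τ : Setoid (Fin n)}
    (h : permutePartition g' (extendPartition e π) = extendPartition e τ)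
    (hg : ∀ a ∈ partitionSupport π, e (g a) = g' (e a)) : permutePartition g π = τ := by
  rw [eq_permutePartition_iff] at h ⊢
  intro a b
  by_cases hab : a = b
  · subst hab
    exact ⟨fun _ => τ.refl _, fun _ => π.refl _⟩
  constructor
  · intro hπ
    have ha := hg a (mem_partitionSupport.2 ⟨b, Ne.symm hab, hπ⟩)
    have hb := hg b (mem_partitionSupport.2 ⟨a, hab, π.symm hπ⟩)
    rw [← extendPartition_apply (e := e), ha, hb, ← h]
    exact extendPartition_apply.2 hπ
  · intro hτ
    rw [← extendPartition_apply (e := e), ← g'.apply_symm_apply (e (g a)),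
      ← g'.apply_symm_apply (e (g b)), ← h] at hτ
    rcases hτ with hτ | ⟨x, y, hx, hy, hxy⟩
    · exact absurd (g.injective (e.injective (g'.symm.injective hτ))) hab
    · by_cases hne : x = y
      · subst hne
        exact absurd (g.injective (e.injective (g'.symm.injective (hx.symm.trans hy)))) hab
      have hxs := hg x (mem_partitionSupport.2 ⟨y, Ne.symm hne, hxy⟩)
      have hys := hg y (mem_partitionSupport.2 ⟨x, hne, π.symm hxy⟩)
      rw [hx, g'.apply_symm_apply] at hxs
      rw [hy, g'.apply_symm_apply] at hys
      rwa [← g.injective (e.injective hxs), ← g.injective (e.injective hys)]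

/-- Extension of partitions by singletons, as an embedding of rank-selected posets. -/
def extendRankSelected (e : Fin n ↪ Fin n') (S : Finset ℕ) : RankSelected n S ↪o RankSelected n' S :=
  OrderEmbedding.ofMapLEIff
    (fun π => ⟨extendPartition e π.1, by rw [partitionRank_extendPartition]; exact π.2⟩)
    fun _ _ => extendPartition_le_iff

theorem coe_extendRankSelected (e : Fin n ↪ Fin n') (S : Finset ℕ) (π : RankSelected n S) :
    (extendRankSelected e S π).1 = extendPartition e π.1 :=
  rfl

theorem moveChain_eq_iff {S : Finset ℕ} {j : ℕ} {g : Perm (Fin n)} {c d : Fin j ↪o RankSelected n S} :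
    moveChain (permAut n S g) c = d ↔ ∀ i, permutePartition g (c i).1 = (d i).1 := by
  constructor
  · rintro rfl i
    rfl
  · intro h
    ext1 i
    exact Subtype.ext (h i)

/-- All partitions in a chain are supported on a common small set. -/
theorem exists_support_chain {S : Finset ℕ} {M j : ℕ} (hM : ∀ s ∈ S, s ≤ M)
    (c : Fin j ↪o RankSelected n S) :
    ∃ T : Finset (Fin n), T.card ≤ 2 * M ∧ ∀ i, partitionSupport (c i).1 ⊆ T := by
  cases j with
  | zero => exact ⟨∅, by simp, fun i => i.elim0⟩
  | succ j =>
    refine ⟨partitionSupport (c (Fin.last j)).1, ?_, fun i => partitionSupport_mono ?_⟩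
    · exact (card_partitionSupport_le _).trans
        (Nat.mul_le_mul_left 2 (hM _ (c (Fin.last j)).2))
    · exact c.monotone (Fin.le_last i)

variable {l m m' : ℕ}

@[simp]
theorem youngHom_castAdd (p : Perm (Fin l) × Perm (Fin m)) (i : Fin l) :
    youngHom l m p (Fin.castAdd m i) = Fin.castAdd m (p.1 i) := by
  simp [youngHom]

@[simp]
theorem youngHom_natAdd (p : Perm (Fin l) × Perm (Fin m)) (i : Fin m) :
    youngHom l m p (Fin.natAdd l i) = Fin.natAdd l (p.2 i) := by
  simp [youngHom]

/-- The inclusion of `Fin (l + m)` as the initial segment of `Fin (l + m')`. -/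
def stabEmb (l : ℕ) (h : m ≤ m') : Fin (l + m) ↪ Fin (l + m') :=
  Fin.castLEEmb (Nat.add_le_add_left h l)

theorem stabEmb_castAdd (h : m ≤ m') (i : Fin l) :
    stabEmb l h (Fin.castAdd m i) = Fin.castAdd m' i :=
  rfl

theorem stabEmb_natAdd (h : m ≤ m') (i : Fin m) :
    stabEmb l h (Fin.natAdd l i) = Fin.natAdd l (Fin.castLE h i) :=
  rfl

theorem exists_perm_eqOn {α : Type*} [Fintype α] [DecidableEq α] (A : Finset α) (f : α → α)
    (hf : Set.InjOn f A) : ∃ g : Perm α, ∀ i ∈ A, g i = f i := by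
  obtain ⟨g, hg⟩ := Finset.exists_equiv_extend_of_card_eq (t := Finset.univ)
    (Finset.card_univ (α := α)).symm (Finset.subset_univ _) hf
  exact ⟨g.trans (Equiv.subtypeUnivEquiv Finset.mem_univ), hg⟩

/-- Injectivity on orbits. The permutation `g'` need not preserve the first m of its points, but it
carries the support of `c` into that of `d`, hence into the smaller set. Its restriction to the
support is injective and extends to a permutation of the m points. -/
theorem exists_moveChain_eq_of_extend {S : Finset ℕ} {j : ℕ} (h : m ≤ m')
    (c d : Fin j ↪o RankSelected (l + m) S) (g' : Perm (Fin m'))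
    (hcd : moveChain (permAut _ S (youngHom l m' (1, g')))
      (c.trans (extendRankSelected (stabEmb l h) S)) =
        d.trans (extendRankSelected (stabEmb l h) S)) :
    ∃ g : Perm (Fin m), moveChain (permAut _ S (youngHom l m (1, g))) c = d := by
  classical
  let A : Finset (Fin m) :=
    Finset.univ.filter fun i => ∃ k, Fin.natAdd l i ∈ partitionSupport (c k).1
  rw [moveChain_eq_iff] at hcd
  have hA : ∀ i ∈ A, (g' (Fin.castLE h i) : ℕ) < m := by
    intro i hi
    obtain ⟨k, hk⟩ := (Finset.mem_filter.1 hi).2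
    obtain ⟨b, hb, hib⟩ := mem_partitionSupport.1 hk
    have h1 : permutePartition (youngHom l m' (1, g'))
        (extendPartition (stabEmb l h) (c k).1) (youngHom l m' (1, g') (stabEmb l h (Fin.natAdd l i)))
        (youngHom l m' (1, g') (stabEmb l h b)) :=
      permutePartition_apply.2 (extendPartition_apply.2 hib)
    have h2 : extendPartition (stabEmb l h) (d k).1
        (youngHom l m' (1, g') (stabEmb l h (Fin.natAdd l i)))
        (youngHom l m' (1, g') (stabEmb l h b)) := by
      have := hcd k
      simp only [RelEmbedding.coe_trans, Function.comp_apply, coe_extendRankSelected] at this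
      rwa [← this]
    rcases h2 with h2 | ⟨x, -, hx, -, -⟩
    · exact absurd ((stabEmb l h).injective ((youngHom l m' (1, g')).injective h2)).symm hb
    · rw [stabEmb_natAdd, youngHom_natAdd] at hx
      have h3 : (x : ℕ) = l + g' (Fin.castLE h i) := congrArg Fin.val hx
      have h4 := x.2
      omega
  -- The default value `i` only makes the function total; by `hA` it is never taken on `A`.
  obtain ⟨g, hg⟩ := exists_perm_eqOn A
    (fun i => if hi : (g' (Fin.castLE h i) : ℕ) < m then ⟨_, hi⟩ else i) (by
      intro i hi k hk hik
      simp only [hA i hi, hA k hk, dif_pos, Fin.mk.injEq] at hik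
      exact Fin.castLE_injective h (g'.injective (Fin.ext hik)))
  refine ⟨g, moveChain_eq_iff.2 fun k => permutePartition_eq_of_extendPartition (hcd k) ?_⟩
  intro a
  refine Fin.addCases (fun i _ => ?_) (fun i hi => ?_) a
  · simp [stabEmb_castAdd]
  · have hi' : i ∈ A := Finset.mem_filter.2 ⟨Finset.mem_univ _, k, hi⟩
    rw [youngHom_natAdd, stabEmb_natAdd, stabEmb_natAdd, youngHom_natAdd, hg i hi']
    simp only [hA i hi', dif_pos]
    rfl

/-- Surjectivity on orbits, the place where 2M ≤ m enters: at most 2M of the last m' points are in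
the support, so a permutation packs them into the first m. The moved chain is then the extension of
its restriction. -/
theorem exists_moveChain_extend_eq {S : Finset ℕ} {M j : ℕ} (hM : ∀ s ∈ S, s ≤ M) (h : m ≤ m')
    (hm : 2 * M ≤ m) (d : Fin j ↪o RankSelected (l + m') S) :
    ∃ (g' : Perm (Fin m')) (c : Fin j ↪o RankSelected (l + m) S),
      moveChain (permAut _ S (youngHom l m' (1, g')))
        (c.trans (extendRankSelected (stabEmb l h) S)) = d := by
  classical
  obtain ⟨T, hT, hd⟩ := exists_support_chain hM d
  let A : Finset (Fin m') := Finset.univ.filter fun i => Fin.natAdd l i ∈ T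
  have hA : A.card ≤ m := by
    refine le_trans ?_ (hT.trans hm)
    rw [← Finset.card_map (Fin.natAddEmb l)]
    refine Finset.card_le_card fun a ha => ?_
    obtain ⟨i, hi, rfl⟩ := Finset.mem_map.1 ha
    exact (Finset.mem_filter.1 hi).2
  -- An enumeration of `A` sends it onto an initial segment of length `A.card ≤ m`; the default
  -- value is irrelevant off `A`.
  obtain ⟨g, hg⟩ := exists_perm_eqOn A
    (fun i => if hi : i ∈ A then Fin.castLE (hA.trans h) (A.equivFin ⟨i, hi⟩) else i) (by
      intro i hi k hk hik
      simp only [Finset.mem_coe.1 hi, Finset.mem_coe.1 hk, dif_pos] at hik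
      exact congrArg Subtype.val (A.equivFin.injective (Fin.castLE_injective _ hik)))
  have hrange : ∀ i, extendPartition (stabEmb l h)
      ((permutePartition (youngHom l m' (1, g)) (d i).1).comap (stabEmb l h)) =
        permutePartition (youngHom l m' (1, g)) (d i).1 := by
    refine fun i => extendPartition_comap fun a ha => ?_
    have ha' := hd i (mem_partitionSupport_permutePartition ha)
    rw [← map_inv] at ha'
    revert ha'
    refine Fin.addCases (fun k _ => ?_) (fun k hk => ?_) a
    · exact ⟨Fin.castAdd m k, rfl⟩
    · rw [Prod.inv_mk, youngHom_natAdd] at hk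
      have hkA : g⁻¹ k ∈ A := Finset.mem_filter.2 ⟨Finset.mem_univ _, hk⟩
      have hgk := hg _ hkA
      rw [show g (g⁻¹ k) = k from g.apply_symm_apply k, dif_pos hkA] at hgk
      have hlt : (k : ℕ) < m := by
        rw [hgk]
        exact (A.equivFin ⟨g⁻¹ k, hkA⟩).is_lt.trans_le hA
      exact ⟨Fin.natAdd l ⟨k, hlt⟩, rfl⟩
  refine ⟨g⁻¹, OrderEmbedding.ofMapLEIff
    (fun i => ⟨(permutePartition (youngHom l m' (1, g)) (d i).1).comap (stabEmb l h), ?_⟩) ?_, ?_⟩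
  · rw [← partitionRank_extendPartition (stabEmb l h), hrange, partitionRank_permutePartition]
    exact (d i).2
  · intro i k
    change Setoid.comap _ _ ≤ Setoid.comap _ _ ↔ _
    rw [← extendPartition_le_iff (e := stabEmb l h), hrange, hrange, ← d.le_iff_le]
    exact (permAut _ S (youngHom l m' (1, g))).le_iff_le (x := d i) (y := d k)
  · rw [moveChain_eq_iff]
    intro i
    refine (congrArg _ (hrange i)).trans ?_
    have := permutePartition_inv (youngHom l m' (1, g)) (d i).1
    rwa [← map_inv, Prod.inv_mk, inv_one] at this

/-- Extending a permutation of the last `m` points to the last `m'` points by the identity. -/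
theorem exists_youngHom_stabEmb (h : m ≤ m') (g : Perm (Fin m)) :
    ∃ g' : Perm (Fin m'), ∀ a,
      youngHom l m' (1, g') (stabEmb l h a) = stabEmb l h (youngHom l m (1, g) a) := by
  refine ⟨g.viaEmbedding (Fin.castLEEmb h), fun a => ?_⟩
  refine Fin.addCases (fun i => ?_) (fun i => ?_) a
  · simp [stabEmb_castAdd]
  · rw [stabEmb_natAdd, youngHom_natAdd, youngHom_natAdd, stabEmb_natAdd]
    exact congrArg _ (g.viaEmbedding_apply (Fin.castLEEmb h) i)

theorem youngHom_stabEmb_left (h : m ≤ m') (g : Perm (Fin l)) (a : Fin (l + m)) :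
    youngHom l m' (g, 1) (stabEmb l h a) = stabEmb l h (youngHom l m (g, 1) a) := by
  refine Fin.addCases (fun i => ?_) (fun i => ?_) a
  · simp [stabEmb_castAdd]
  · simp [stabEmb_natAdd]

theorem moveChain_extend {S : Finset ℕ} {j : ℕ} {e : Fin n ↪ Fin n'} {g : Perm (Fin n)}
    {g' : Perm (Fin n')} (h : ∀ x, g' (e x) = e (g x)) (c : Fin j ↪o RankSelected n S) :
    moveChain (permAut n' S g') (c.trans (extendRankSelected e S)) =
      (moveChain (permAut n S g) c).trans (extendRankSelected e S) :=
  moveChain_eq_iff.2 fun i => extendPartition_permutePartition h (c i).1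

end ChainStability

/-! ### Stability of the chain spaces and of the top homology -/

section ChainSpaces

variable {P Q : Type} [PartialOrder P] [PartialOrder Q]

/-- The basis of the space of chains given by the chains themselves. -/
noncomputable def chainBasis (P : Type) [PartialOrder P] (j : ℕ) :
    Module.Basis (Fin j ↪o P) ℂ (Chains P j) :=
  Module.Basis.ofRepr (LinearEquiv.refl ℂ (Chains P j))

theorem chainRep_chainBasis {j : ℕ} (e : P ≃o P) (c : Fin j ↪o P) :
    chainRep P j e (chainBasis P j c) = chainBasis P j (moveChain e c) :=
  Finsupp.mapDomain_single

/-- The map on chain spaces induced by an order embedding. -/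
noncomputable def pushChains (f : P ↪o Q) (j : ℕ) : Chains P j →ₗ[ℂ] Chains Q j :=
  Finsupp.lmapDomain ℂ ℂ fun c => c.trans f

theorem pushChains_chainBasis (f : P ↪o Q) {j : ℕ} (c : Fin j ↪o P) :
    pushChains f j (chainBasis P j c) = chainBasis Q j (c.trans f) :=
  Finsupp.mapDomain_single

theorem boundary_chainBasis {j : ℕ} (c : Fin (j + 1) ↪o P) :
    boundary P j (chainBasis P (j + 1) c) =
      ∑ i : Fin (j + 1), (-1 : ℂ) ^ (i : ℕ) • chainBasis P j ((Fin.succAboveOrderEmb i).trans c) := by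
  refine (Finsupp.linearCombination_single ℂ (1 : ℂ) c).trans ?_
  rw [one_smul]
  refine Finset.sum_congr rfl fun i _ => ?_
  exact (Finsupp.smul_single_one _ _).symm

theorem boundary_pushChains (f : P ↪o Q) (j : ℕ) (v : Chains P (j + 1)) :
    boundary Q j (pushChains f (j + 1) v) = pushChains f j (boundary P j v) := by
  refine LinearMap.congr_fun (f := boundary Q j ∘ₗ pushChains f (j + 1))
    (g := pushChains f j ∘ₗ boundary P j) ((chainBasis P (j + 1)).ext fun c => ?_) v
  simp only [LinearMap.comp_apply, pushChains_chainBasis, boundary_chainBasis, map_sum, map_smul]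
  rfl

end ChainSpaces

/-! ### Symmetrized extension by singletons. -/

section Stability

variable {l m m' : ℕ}

/-- The representation of the symmetric group on the `j`-element chains of `Π_n(S)`. -/
noncomputable abbrev rankChainRep (n : ℕ) (S : Finset ℕ) (j : ℕ) :
    Representation ℂ (Perm (Fin n)) (Chains (RankSelected n S) j) :=
  (chainRep (RankSelected n S) j).comp (permAut n S)

theorem rankChainRep_chainBasis {n : ℕ} {S : Finset ℕ} {j : ℕ} (g : Perm (Fin n))
    (c : Fin j ↪o RankSelected n S) :
    rankChainRep n S j g (chainBasis _ j c) = chainBasis _ j (moveChain (permAut n S g) c) :=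
  chainRep_chainBasis _ _

theorem boundary_rankChainRep {n : ℕ} {S : Finset ℕ} {j : ℕ} (g : Perm (Fin n))
    (v : Chains (RankSelected n S) (j + 1)) :
    boundary _ j (rankChainRep n S (j + 1) g v) = rankChainRep n S j g (boundary _ j v) :=
  boundary_chainRep _ _ _ _

/-- The stabilization map on chains: extend by singletons and symmetrize over `S_{m'}`. -/
noncomputable def stabMap (S : Finset ℕ) (h : m ≤ m') (j : ℕ) :
    Chains (RankSelected (l + m) S) j →ₗ[ℂ] Chains (RankSelected (l + m') S) j :=
  Representation.norm ((rankChainRep (l + m') S j).comp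
    ((youngHom l m').comp (MonoidHom.inr _ _))) ∘ₗ pushChains (extendRankSelected (stabEmb l h) S) j

theorem stabMap_apply (S : Finset ℕ) (h : m ≤ m') (j : ℕ)
    (v : Chains (RankSelected (l + m) S) j) :
    stabMap S h j v = ∑ g : Perm (Fin m'), rankChainRep (l + m') S j (youngHom l m' (1, g))
      (pushChains (extendRankSelected (stabEmb l h) S) j v) :=
  LinearMap.sum_apply _ _ _

theorem rankChainRep_pushChains {n n' : ℕ} (S : Finset ℕ) (j : ℕ) {e : Fin n ↪ Fin n'}
    {g : Perm (Fin n)} {g' : Perm (Fin n')} (h : ∀ x, g' (e x) = e (g x))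
    (v : Chains (RankSelected n S) j) :
    rankChainRep n' S j g' (pushChains (extendRankSelected e S) j v) =
      pushChains (extendRankSelected e S) j (rankChainRep n S j g v) := by
  refine LinearMap.congr_fun (f := rankChainRep n' S j g' ∘ₗ pushChains (extendRankSelected e S) j)
    (g := pushChains (extendRankSelected e S) j ∘ₗ rankChainRep n S j g)
    ((chainBasis _ j).ext fun c => ?_) v
  simp only [LinearMap.comp_apply, pushChains_chainBasis, rankChainRep_chainBasis]
  rw [moveChain_extend h]

theorem stabMap_mem_skewSpace (S : Finset ℕ) (h : m ≤ m') (j : ℕ)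
    (v : Chains (RankSelected (l + m) S) j) :
    stabMap S h j v ∈ skewSpace (rankChainRep (l + m') S j) :=
  fun g => Representation.self_norm_apply ((rankChainRep (l + m') S j).comp
    ((youngHom l m').comp (MonoidHom.inr _ _))) g _

theorem stabMap_youngHom_left (S : Finset ℕ) (h : m ≤ m') (j : ℕ) (g : Perm (Fin l))
    (v : Chains (RankSelected (l + m) S) j) :
    stabMap S h j (rankChainRep (l + m) S j (youngHom l m (g, 1)) v) =
      rankChainRep (l + m') S j (youngHom l m' (g, 1)) (stabMap S h j v) := by
  simp only [stabMap_apply, map_sum]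
  refine Finset.sum_congr rfl fun k _ => ?_
  rw [← rankChainRep_pushChains S j (youngHom_stabEmb_left h g), ← Module.End.mul_apply,
    ← Module.End.mul_apply, ← map_mul, ← map_mul, ← map_mul, ← map_mul]
  simp

theorem boundary_stabMap (S : Finset ℕ) (h : m ≤ m') (j : ℕ)
    (v : Chains (RankSelected (l + m) S) (j + 1)) :
    boundary _ j (stabMap S h (j + 1) v) = stabMap S h j (boundary _ j v) := by
  simp only [stabMap_apply, map_sum, boundary_rankChainRep, boundary_pushChains]

instance finite_setoid (α : Type*) [Finite α] : Finite (Setoid α) :=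
  Finite.of_injective (fun π : Setoid α => fun a b => π a b) fun _ _ h =>
    Setoid.ext fun a b => iff_of_eq (congrFun (congrFun h a) b)

instance finite_chains (n : ℕ) (S : Finset ℕ) (j : ℕ) : Finite (Fin j ↪o RankSelected n S) :=
  DFunLike.finite _

theorem stabMap_injOn (S : Finset ℕ) (h : m ≤ m') (j : ℕ)
    {v : Chains (RankSelected (l + m) S) j} (hv : v ∈ skewSpace (rankChainRep (l + m) S j))
    (h0 : stabMap S h j v = 0) : v = 0 := by
  have := Fintype.ofFinite (Fin j ↪o RankSelected (l + m) S)
  exact norm_comp_injOn_invariants _ _ (chainBasis _ j) (chainBasis _ j)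
    (fun g c => moveChain (permAut _ S (youngHom l m (1, g))) c)
    (fun g c => moveChain (permAut _ S (youngHom l m' (1, g))) c)
    (fun g c => rankChainRep_chainBasis _ c) (fun g c => rankChainRep_chainBasis _ c)
    (pushChains (extendRankSelected (stabEmb l h) S) j) _ (fun c => pushChains_chainBasis _ c)
    (fun c d g hcd => exists_moveChain_eq_of_extend h c d g hcd) hv h0

theorem stabMap_surjOn {S : Finset ℕ} {M : ℕ} (hM : ∀ s ∈ S, s ≤ M) (h : m ≤ m')
    (hm : 2 * M ≤ m) (j : ℕ) {w : Chains (RankSelected (l + m') S) j}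
    (hw : w ∈ skewSpace (rankChainRep (l + m') S j)) :
    ∃ v ∈ skewSpace (rankChainRep (l + m) S j), stabMap S h j v = w := by
  refine norm_comp_surjOn_invariants _ _ (chainBasis _ j) (chainBasis _ j)
    (fun g c => moveChain (permAut _ S (youngHom l m' (1, g))) c)
    (fun g c => rankChainRep_chainBasis _ c)
    (pushChains (extendRankSelected (stabEmb l h) S) j) _ (fun c => pushChains_chainBasis _ c)
    (fun d => exists_moveChain_extend_eq hM h hm d) (fun g => ?_) hw
  obtain ⟨g', hg'⟩ := exists_youngHom_stabEmb (l := l) h g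
  exact ⟨g', fun v => rankChainRep_pushChains S j hg' v⟩

theorem nonempty_skewRow_rankChainRep {S : Finset ℕ} {M : ℕ} (hM : ∀ s ∈ S, s ≤ M) (h : m ≤ m')
    (hm : 2 * M ≤ m) (j : ℕ) :
    Nonempty ((skewRow (rankChainRep (l + m) S j)).Equiv
      (skewRow (rankChainRep (l + m') S j))) :=
  nonempty_skewRow_equiv _ _ (stabMap S h j) (fun g v => stabMap_youngHom_left S h j g v)
    (fun v _ => stabMap_mem_skewSpace S h j v) (fun _ hv h0 => stabMap_injOn S h j hv h0)
    fun _ hw => stabMap_surjOn hM h hm j hw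

theorem stabMap_mem_cycles {S : Finset ℕ} (h : m ≤ m') {j : ℕ}
    {v : Chains (RankSelected (l + m) S) j} (hv : v ∈ cycles _ j) :
    stabMap S h j v ∈ cycles _ j := by
  cases j with
  | zero => trivial
  | succ j =>
    have hv' : boundary _ j v = 0 := hv
    change boundary _ j _ = 0
    rw [boundary_stabMap, hv', map_zero]

/-- The boundary of `v` is again invariant and is killed by the stabilization map one degree lower,
which is injective on invariants. -/
theorem mem_cycles_of_stabMap {S : Finset ℕ} (h : m ≤ m') {j : ℕ}
    {v : Chains (RankSelected (l + m) S) j} (hv : v ∈ skewSpace (rankChainRep (l + m) S j))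
    (hT : stabMap S h j v ∈ cycles _ j) : v ∈ cycles _ j := by
  cases j with
  | zero => trivial
  | succ j =>
    have hT' : boundary _ j (stabMap S h (j + 1) v) = 0 := hT
    rw [boundary_stabMap] at hT'
    refine stabMap_injOn S h j (fun g => ?_) hT'
    exact (boundary_rankChainRep _ v).symm.trans (congrArg _ (hv g))

theorem nonempty_skewRow_cyclesRep {S : Finset ℕ} {M : ℕ} (hM : ∀ s ∈ S, s ≤ M) (h : m ≤ m')
    (hm : 2 * M ≤ m) (j : ℕ) :
    Nonempty ((skewRow ((cyclesRep (RankSelected (l + m) S) j).comp (permAut _ S))).Equiv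
      (skewRow ((cyclesRep (RankSelected (l + m') S) j).comp (permAut _ S)))) := by
  refine nonempty_skewRow_equiv _ _
    ((stabMap S h j).restrict fun v hv => stabMap_mem_cycles h hv) ?_ ?_ ?_ ?_
  · exact fun g v => Subtype.ext (stabMap_youngHom_left S h j g v.1)
  · exact fun v _ g => Subtype.ext (stabMap_mem_skewSpace S h j v.1 g)
  · intro v hv h0
    refine Subtype.ext (stabMap_injOn S h j (fun g => ?_) (congrArg Subtype.val h0))
    exact congrArg Subtype.val (hv g)
  · rintro ⟨w, hwc⟩ hw
    obtain ⟨v, hv, rfl⟩ := stabMap_surjOn hM h hm j fun g => congrArg Subtype.val (hw g)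
    exact ⟨⟨v, mem_cycles_of_stabMap h hv hwc⟩, fun g => Subtype.ext (hv g), rfl⟩

/-! ### Lengths of chains, and top homology as a cycle space. -/

theorem partitionRank_strictMono {n : ℕ} {π τ : Setoid (Fin n)} (h : π < τ) :
    partitionRank π < partitionRank τ := by
  have hlt : Nat.card (Quotient τ) < Nat.card (Quotient π) := by
    have hsurj : Function.Surjective (Quotient.map' (s₁ := π) (s₂ := τ) id fun _ _ hab => h.le hab) := by
      intro q
      induction q using Quotient.inductionOn' with
      | h a => exact ⟨Quotient.mk'' a, rfl⟩
    refine lt_of_le_of_ne (Nat.card_le_card_of_surjective _ hsurj) fun heq => h.not_ge ?_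
    have hinj := (Function.Surjective.bijective_of_nat_card_le hsurj heq.ge).1
    intro a b hab
    exact Quotient.exact' (@hinj (Quotient.mk'' a) (Quotient.mk'' b) (Quotient.sound' hab))
  have := card_quotient_le π
  unfold partitionRank
  omega

theorem card_chain_le {n j : ℕ} {S : Finset ℕ} (c : Fin j ↪o RankSelected n S) : j ≤ S.card := by
  have hmono : StrictMono fun i => partitionRank (c i).1 := fun a b hab =>
    partitionRank_strictMono (c.strictMono hab)
  have := Finset.card_le_card_of_injOn (s := Finset.univ) (t := S) (fun i => partitionRank (c i).1)
    (fun i _ => (c i).2) hmono.injective.injOn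
  simpa using this

/-- Ranks increase strictly along a chain, so there are no chains with |S| + 1 elements to bound
anything. -/
theorem boundaries_card_eq_bot (n : ℕ) (S : Finset ℕ) :
    boundaries (RankSelected n S) S.card = ⊥ := by
  have : IsEmpty (Fin (S.card + 1) ↪o RankSelected n S) :=
    ⟨fun c => absurd (card_chain_le c) (by omega)⟩
  rw [eq_bot_iff]
  rintro v ⟨w, hw⟩
  have hw0 : w = 0 := (chainBasis _ (S.card + 1)).ext_elem fun c => isEmptyElim c
  rw [hw0, map_zero] at hw
  exact Subtype.ext hw.symm

theorem nonempty_betaRep_equiv_cyclesRep (n : ℕ) (S : Finset ℕ) :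
    Nonempty (Representation.Equiv
      ((cyclesRep (RankSelected n S) S.card).comp (permAut n S)) (betaRep n S)) :=
  ⟨Representation.Equiv.mk
    (Submodule.quotEquivOfEqBot _ (boundaries_card_eq_bot n S)).symm fun _ => rfl⟩

theorem nonempty_skewRow_betaRep_of_le {S : Finset ℕ} {M : ℕ} (hM : ∀ s ∈ S, s ≤ M) (h : m ≤ m')
    (hm : 2 * M ≤ m) :
    Nonempty ((skewRow (betaRep (l + m) S)).Equiv (skewRow (betaRep (l + m') S))) := by
  obtain ⟨e₁⟩ := nonempty_betaRep_equiv_cyclesRep (l + m) S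
  obtain ⟨e₂⟩ := nonempty_betaRep_equiv_cyclesRep (l + m') S
  obtain ⟨f₁⟩ := e₁.nonempty_skewRow
  obtain ⟨f₂⟩ := e₂.nonempty_skewRow
  obtain ⟨f⟩ := nonempty_skewRow_cyclesRep (l := l) hM h hm S.card
  exact ⟨(f₁.symm.trans f).trans f₂⟩

end Stability

/-! ### Maximal chains of the rank-selected partition lattice -/

section Flags

variable {n : ℕ} {S : Finset ℕ}

/-- Merge two blocks of `π` that lie in one block of `τ`. The map `f` redirects the class of `y` to
that of `x`; its range misses only the class of `y`, so its kernel has one block fewer. -/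
theorem exists_partitionRank_succ {π τ : Setoid (Fin n)} (h : π < τ) :
    ∃ σ, π ≤ σ ∧ σ ≤ τ ∧ partitionRank σ = partitionRank π + 1 := by
  classical
  obtain ⟨x, y, hτ, hπ⟩ : ∃ x y, τ x y ∧ ¬ π x y := by
    by_contra! hcon
    exact h.not_ge fun a b hab => hcon a b hab
  let f : Fin n → Quotient π := fun a =>
    if Quotient.mk π a = Quotient.mk π y then Quotient.mk π x else Quotient.mk π a
  have hf : Set.range f = {Quotient.mk π y}ᶜ := by
    ext q
    rw [Set.mem_range, Set.mem_compl_singleton_iff]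
    constructor
    · rintro ⟨a, rfl⟩
      by_cases ha : Quotient.mk π a = Quotient.mk π y
      · simp only [f, ha, if_true]
        exact fun hxy => hπ (Quotient.exact hxy)
      · simpa only [f, ha, if_false]
    · intro hq
      induction q using Quotient.inductionOn with
      | h a => exact ⟨a, if_neg hq⟩
  refine ⟨Setoid.ker f, ?_, ?_, ?_⟩
  · intro a b hab
    have : Quotient.mk π a = Quotient.mk π b := Quotient.sound hab
    simp only [Setoid.ker_def, f, this]
  · have key : ∀ a, ∃ a', f a = Quotient.mk π a' ∧ τ a a' := by
      intro a
      by_cases ha : Quotient.mk π a = Quotient.mk π y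
      · exact ⟨x, if_pos ha, τ.trans (h.le (Quotient.exact ha)) (τ.symm hτ)⟩
      · exact ⟨a, if_neg ha, τ.refl a⟩
    intro a b hab
    obtain ⟨a', ha, ha'⟩ := key a
    obtain ⟨b', hb, hb'⟩ := key b
    have hab' : Quotient.mk π a' = Quotient.mk π b' := by rw [← ha, ← hb]; exact hab
    exact τ.trans ha' (τ.trans (h.le (Quotient.exact hab')) (τ.symm hb'))
  · have hcard : Nat.card (Quotient (Setoid.ker f)) = Nat.card (Quotient π) - 1 := by
      rw [Nat.card_congr (Setoid.quotientKerEquivRange f), hf, Nat.card_eq_fintype_card,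
        Fintype.card_compl_set, Nat.card_eq_fintype_card]
      simp
    have h1 := card_quotient_le π
    have h2 : 0 < Nat.card (Quotient π) :=
      Nat.card_pos_iff.2 ⟨⟨Quotient.mk π x⟩, inferInstance⟩
    unfold partitionRank
    omega

theorem exists_partitionRank_eq {π τ : Setoid (Fin n)} (h : π ≤ τ) {s : ℕ}
    (hπ : partitionRank π ≤ s) (hτ : s ≤ partitionRank τ) :
    ∃ σ, π ≤ σ ∧ σ ≤ τ ∧ partitionRank σ = s := by
  obtain ⟨d, rfl⟩ := Nat.exists_eq_add_of_le hπ
  induction d generalizing π with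
  | zero => exact ⟨π, le_rfl, h, rfl⟩
  | succ d ih =>
    have hlt : π < τ := lt_of_le_of_ne h (by rintro rfl; omega)
    obtain ⟨σ, h1, h2, h3⟩ := exists_partitionRank_succ hlt
    obtain ⟨ρ, h4, h5, h6⟩ := ih h2 (by omega) (by omega)
    exact ⟨ρ, h1.trans h4, h5, by omega⟩

theorem partitionRank_bot : partitionRank (⊥ : Setoid (Fin n)) = 0 := by
  have : Nat.card (Quotient (⊥ : Setoid (Fin n))) = n := by
    have hinj : Function.Injective (Quotient.mk (⊥ : Setoid (Fin n))) :=
      fun a b h => Quotient.exact h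
    simpa using (Nat.card_eq_of_bijective _ ⟨hinj, Quotient.mk_surjective⟩).symm
  simp [partitionRank, this]

theorem le_partitionRank_top : n - 1 ≤ partitionRank (⊤ : Setoid (Fin n)) := by
  have : Subsingleton (Quotient (⊤ : Setoid (Fin n))) :=
    ⟨fun a b => by
      induction a, b using Quotient.inductionOn₂ with
      | h a b => exact Quotient.sound trivial⟩
  have := Finite.card_le_one_iff_subsingleton.2 this
  unfold partitionRank
  omega

theorem eq_of_partitionRank_eq {π τ : Setoid (Fin n)} (h : π ≤ τ ∨ τ ≤ π)
    (hr : partitionRank π = partitionRank τ) : π = τ := by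
  rcases h with h | h
  · exact h.eq_or_lt.resolve_right fun hlt => (partitionRank_strictMono hlt).ne hr
  · exact (h.eq_or_lt.resolve_right fun hlt => (partitionRank_strictMono hlt).ne hr.symm).symm

/-- A maximal chain of `Π_n(S)` meets every rank in `S`. -/
theorem exists_mem_flag_partitionRank (hS : ∀ s ∈ S, s ≤ n - 1) (F : Flag (RankSelected n S))
    {s : ℕ} (hs : s ∈ S) : ∃ π ∈ F, partitionRank π.1 = s := by
  -- Adjoining bottom and top guarantees that elements of `C` exist on both sides of rank `s`.
  let C : Set (Setoid (Fin n)) := insert ⊥ (insert ⊤ (Subtype.val '' (F : Set (RankSelected n S))))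
  have hC : ∀ π ∈ C, ∀ τ ∈ C, π ≤ τ ∨ τ ≤ π := by
    rintro π (rfl | rfl | ⟨π, hπ, rfl⟩) τ (rfl | rfl | ⟨τ, hτ, rfl⟩)
    all_goals first
      | exact Or.inl bot_le
      | exact Or.inl le_top
      | exact Or.inr bot_le
      | exact Or.inr le_top
      | exact F.le_or_le hπ hτ
  have hcmp : ∀ π ∈ C, ∀ τ ∈ C, partitionRank π ≤ partitionRank τ → π ≤ τ := by
    intro π hπ τ hτ hle
    rcases hC π hπ τ hτ with h | h
    · exact h
    · exact h.eq_or_lt.elim (fun h => h.ge) fun hlt => absurd (partitionRank_strictMono hlt) hle.not_gt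
  obtain ⟨a, ⟨haC, has⟩, ha⟩ := Set.exists_max_image {π ∈ C | partitionRank π ≤ s} partitionRank
    (Set.toFinite _) ⟨⊥, Set.mem_insert _ _, by simp [partitionRank_bot]⟩
  obtain ⟨b, ⟨hbC, hbs⟩, hb⟩ := Set.exists_min_image {π ∈ C | s ≤ partitionRank π} partitionRank
    (Set.toFinite _) ⟨⊤, Set.mem_insert_of_mem _ (Set.mem_insert _ _),
      (hS s hs).trans le_partitionRank_top⟩
  -- An element of rank `s` between the neighbours `a` and `b` is comparable with the whole flag, so
  -- maximality puts it in the flag.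
  obtain ⟨σ, haσ, hσb, hσ⟩ := exists_partitionRank_eq (hcmp a haC b hbC (has.trans hbs)) has hbs
  refine ⟨⟨σ, hσ ▸ hs⟩, Flag.mem_iff_forall_le_or_ge.2 fun π hπ => ?_, hσ⟩
  have hπC : π.1 ∈ C := Set.mem_insert_of_mem _ (Set.mem_insert_of_mem _ ⟨π, hπ, rfl⟩)
  rcases le_total (partitionRank π.1) s with h | h
  · exact Or.inr ((hcmp _ hπC _ haC (ha _ ⟨hπC, h⟩)).trans haσ)
  · exact Or.inl (hσb.trans (hcmp _ hbC _ hπC (hb _ ⟨hπC, h⟩)))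

/-- A chain with `|S|` elements is a maximal chain of `Π_n(S)`. -/
def flagOfChain (c : Fin S.card ↪o RankSelected n S) : Flag (RankSelected n S) where
  carrier := Set.range c
  Chain' := by
    rintro _ ⟨i, rfl⟩ _ ⟨j, rfl⟩ -
    exact (le_total i j).imp (fun h => c.monotone h) fun h => c.monotone h
  max_chain' := by
    intro T hT hsub
    refine hsub.antisymm fun x hx => ?_
    have hinj : Function.Injective fun i => (⟨partitionRank (c i).1, (c i).2⟩ : S) := by
      intro i j hij
      refine c.injective (Subtype.ext (eq_of_partitionRank_eq ?_ (congrArg Subtype.val hij)))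
      exact (le_total i j).imp (fun h => c.monotone h) fun h => c.monotone h
    obtain ⟨i, hi⟩ := ((Fintype.bijective_iff_injective_and_card _).2 ⟨hinj, by simp⟩).2
      ⟨partitionRank x.1, x.2⟩
    refine ⟨i, Subtype.ext (eq_of_partitionRank_eq ?_ (congrArg Subtype.val hi))⟩
    exact hT.total (hsub ⟨i, rfl⟩) hx

/-- A maximal chain has exactly one element for each rank in `S`, and a finite chain has a unique
increasing enumeration. -/
theorem flagOfChain_bijective (hS : ∀ s ∈ S, s ≤ n - 1) :
    Function.Bijective (flagOfChain : (Fin S.card ↪o RankSelected n S) → _) := by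
  classical
  constructor
  · intro c d h
    exact DFunLike.coe_injective ((c.strictMono.range_inj d.strictMono).1 (congrArg Flag.carrier h))
  · intro F
    have := Fintype.ofFinite F
    have hbij : Function.Bijective fun π : F => (⟨partitionRank π.1.1, π.1.2⟩ : S) := by
      constructor
      · intro π τ h
        exact Subtype.ext (Subtype.ext (eq_of_partitionRank_eq (F.le_or_le π.2 τ.2)
          (congrArg Subtype.val h)))
      · rintro ⟨s, hs⟩
        obtain ⟨π, hπ, h⟩ := exists_mem_flag_partitionRank hS F hs
        exact ⟨⟨π, hπ⟩, Subtype.ext h⟩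
    have hcard : Fintype.card F = S.card := by
      simpa using Fintype.card_of_bijective hbij
    let o := Fintype.orderIsoFinOfCardEq F hcard
    refine ⟨o.toOrderEmbedding.trans (OrderEmbedding.subtype _), SetLike.coe_injective ?_⟩
    ext x
    constructor
    · rintro ⟨i, rfl⟩
      exact (o i).2
    · exact fun hx => ⟨o.symm ⟨x, hx⟩, congrArg Subtype.val (o.apply_symm_apply ⟨x, hx⟩)⟩

theorem flagOfChain_moveChain (e : RankSelected n S ≃o RankSelected n S)
    (c : Fin S.card ↪o RankSelected n S) : flagOfChain (moveChain e c) = e • flagOfChain c :=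
  SetLike.coe_injective (Set.range_comp e c)

theorem nonempty_rankChainRep_equiv_alphaRep (hS : ∀ s ∈ S, s ≤ n - 1) :
    Nonempty (Representation.Equiv (rankChainRep n S S.card) (alphaRep n S)) := by
  let ε := Equiv.ofBijective _ (flagOfChain_bijective hS)
  let L : Chains (RankSelected n S) S.card ≃ₗ[ℂ] MonoidAlgebra ℂ (Flag (RankSelected n S)) :=
    (Finsupp.domLCongr ε).trans (MonoidAlgebra.coeffLinearEquiv ℂ).symm
  refine ⟨Representation.Equiv.mk L fun g => (chainBasis _ S.card).ext fun c => ?_⟩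
  have hL : ∀ c, L (chainBasis _ S.card c) = MonoidAlgebra.single (flagOfChain c) 1 := fun c =>
    congrArg (MonoidAlgebra.coeffLinearEquiv ℂ).symm (Finsupp.domLCongr_single ε c 1)
  simp only [LinearMap.comp_apply, LinearEquiv.coe_coe, rankChainRep_chainBasis, hL]
  rw [flagOfChain_moveChain]
  exact (Representation.ofMulAction_single _ _ _).symm

theorem nonempty_skewRow_alphaRep_of_le {l m m' M : ℕ} (hM : ∀ s ∈ S, s ≤ M) (h : m ≤ m')
    (hm : 2 * M ≤ m) (hS : ∀ s ∈ S, s ≤ l + m - 1) :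
    Nonempty ((skewRow (alphaRep (l + m) S)).Equiv (skewRow (alphaRep (l + m') S))) := by
  obtain ⟨e₁⟩ := nonempty_rankChainRep_equiv_alphaRep hS
  obtain ⟨e₂⟩ := nonempty_rankChainRep_equiv_alphaRep (n := l + m') (S := S)
    fun s hs => (hS s hs).trans (by omega)
  obtain ⟨f₁⟩ := e₁.nonempty_skewRow
  obtain ⟨f₂⟩ := e₂.nonempty_skewRow
  obtain ⟨f⟩ := nonempty_skewRow_rankChainRep (l := l) hM h hm S.card
  exact ⟨(f₁.symm.trans f).trans f₂⟩

end Flags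

/-- Skewing the rank-selected representations by a long row gives a stable representation. -/
theorem nonempty_skewRow_equiv_of_stable {S : Finset ℕ} {l m m' M : ℕ} (hM : ∀ s ∈ S, s ≤ M)
    (hm : 2 * M ≤ m) (hm' : 2 * M ≤ m') :
    Nonempty ((skewRow (alphaRep (l + m) S)).Equiv (skewRow (alphaRep (l + m') S))) ∧
      Nonempty ((skewRow (betaRep (l + m) S)).Equiv (skewRow (betaRep (l + m') S))) := by
  have hS : ∀ {m}, 2 * M ≤ m → ∀ s ∈ S, s ≤ l + m - 1 := fun h s hs => by
    have := hM s hs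
    omega
  rcases le_total m m' with h | h
  · exact ⟨nonempty_skewRow_alphaRep_of_le hM h hm (hS hm), nonempty_skewRow_betaRep_of_le hM h hm⟩
  · obtain ⟨e⟩ := nonempty_skewRow_alphaRep_of_le (l := l) hM h hm' (hS hm')
    obtain ⟨f⟩ := nonempty_skewRow_betaRep_of_le (l := l) hM h hm'
    exact ⟨⟨e.symm⟩, ⟨f.symm⟩⟩

/-! ### Words and their stabilizers -/

section Words

variable {α β : Type*} [Fintype α] [DecidableEq α] [DecidableEq β]

omit [DecidableEq α] in
theorem exists_perm_comp_iff {v w : α → β} :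
    (∃ h : Perm α, v = w ∘ h) ↔ ∀ b, Fintype.card {a // v a = b} = Fintype.card {a // w a = b} := by
  constructor
  · rintro ⟨h, rfl⟩ b
    exact Fintype.card_congr (h.subtypeEquiv fun _ => Iff.rfl)
  · intro H
    let e : ∀ b, {a // v a = b} ≃ {a // w a = b} := fun b => Fintype.equivOfCardEq (H b)
    exact ⟨Equiv.ofFiberEquiv e, funext fun a => (Equiv.ofFiberEquiv_map e a).symm⟩

omit [DecidableEq α] in
theorem exists_perm_comp_iff_map {v w : α → β} :
    (∃ h : Perm α, v = w ∘ h) ↔ Finset.univ.val.map v = Finset.univ.val.map w := by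
  have hc : ∀ (v : α → β) b, Fintype.card {a // v a = b} = (Finset.univ.val.map v).count b := by
    intro v b
    rw [Multiset.count_map, Fintype.card_subtype]
    simp only [eq_comm]
    rfl
  rw [exists_perm_comp_iff, Multiset.ext]
  simp only [hc]

/-- The sum of a function over the stabilizer of a word. -/
def stabSum (χ : Perm α → ℂ) (v : α → β) : ℂ :=
  ∑ g ∈ Finset.univ.filter fun g : Perm α => v ∘ g = v, χ g

theorem stabSum_comp {χ : Perm α → ℂ} (hχ : ∀ g h, χ (h * g * h⁻¹) = χ g) (v : α → β)
    (h : Perm α) : stabSum χ (v ∘ h) = stabSum χ v := by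
  unfold stabSum
  refine Finset.sum_bij (fun g _ => h * g * h⁻¹) ?_ ?_ ?_ ?_
  · intro g hg
    simp only [Finset.mem_filter, Finset.mem_univ, true_and] at hg ⊢
    funext a
    have := congrFun hg (h⁻¹ a)
    simpa using this
  · intro g₁ _ g₂ _ h12
    simpa using h12
  · intro g hg
    simp only [Finset.mem_filter, Finset.mem_univ, true_and] at hg
    refine ⟨h⁻¹ * g * h, ?_, by group⟩
    simp only [Finset.mem_filter, Finset.mem_univ, true_and]
    funext a
    have := congrFun hg (h a)
    simpa using this
  · intro g _
    exact (hχ g h).symm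

/-- Orbit–stabilizer: the stabilizer of a rearrangement `w` is in bijection with the permutations
taking `v` to `w`, and these sets partition the group. -/
theorem sum_stabSum_one [Fintype β] (v : α → β) :
    ∑ w : α → β with (∃ h : Perm α, w = v ∘ h), stabSum (fun _ => 1) w =
      (Fintype.card α).factorial := by
  classical
  have hfib : ∀ w ∈ Finset.univ.filter fun w : α → β => ∃ h : Perm α, w = v ∘ h,
      stabSum (fun _ => 1) w = ∑ g ∈ Finset.univ.filter fun g : Perm α => v ∘ g = w, (1 : ℂ) := by
    intro w hw
    obtain ⟨h, rfl⟩ := (Finset.mem_filter.1 hw).2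
    unfold stabSum
    refine Finset.sum_bij (fun g _ => h * g) ?_ ?_ ?_ ?_
    · intro g hg
      simp only [Finset.mem_filter, Finset.mem_univ, true_and] at hg ⊢
      exact hg
    · intro g₁ _ g₂ _ h12
      simpa using h12
    · intro g hg
      refine ⟨h⁻¹ * g, ?_, by simp⟩
      simp only [Finset.mem_filter, Finset.mem_univ, true_and] at hg ⊢
      funext a
      have := congrFun hg a
      simpa using this
    · simp
  rw [Finset.sum_congr rfl hfib, Finset.sum_fiberwise_of_maps_to]
  · simp [Fintype.card_perm]
  · exact fun g _ => Finset.mem_filter.2 ⟨Finset.mem_univ _, g, rfl⟩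

/-- Averaging a class function over the stabilizers of all rearrangements of a word. -/
theorem sum_stabSum [Fintype β] {χ : Perm α → ℂ} (hχ : ∀ g h, χ (h * g * h⁻¹) = χ g) (v : α → β) :
    ((Fintype.card α).factorial : ℂ)⁻¹ *
        ∑ w : α → β with (∃ h : Perm α, w = v ∘ h), stabSum χ w =
      (stabSum (fun _ => 1) v)⁻¹ * stabSum χ v := by
  have key : ∀ {ψ : Perm α → ℂ}, (∀ g h, ψ (h * g * h⁻¹) = ψ g) →
      ∑ w : α → β with (∃ h : Perm α, w = v ∘ h), stabSum ψ w =
        ((Finset.univ.filter fun w : α → β => ∃ h : Perm α, w = v ∘ h).card : ℂ) * stabSum ψ v := by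
    intro ψ hψ
    rw [← nsmul_eq_mul]
    refine Finset.sum_eq_card_nsmul fun w hw => ?_
    obtain ⟨h, rfl⟩ := (Finset.mem_filter.1 hw).2
    exact stabSum_comp hψ v h
  have h1 := sum_stabSum_one v
  rw [key fun _ _ => rfl] at h1
  have h0 : ((Fintype.card α).factorial : ℂ) ≠ 0 := Nat.cast_ne_zero.2 (Nat.factorial_ne_zero _)
  rw [key hχ]
  rw [← h1] at h0 ⊢
  have ha := left_ne_zero_of_mul h0
  have hb := right_ne_zero_of_mul h0
  field_simp

end Words

/-! ### Cycles of a permutation and power sums -/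

section Cycles

variable {α : Type*} [Fintype α] [DecidableEq α]

/-- The orbit of a point under a permutation. -/
def cycleBlock (g : Perm α) (a : α) : Finset α :=
  Finset.univ.filter fun b => g.SameCycle a b

theorem mem_cycleBlock {g : Perm α} {a b : α} : b ∈ cycleBlock g a ↔ g.SameCycle a b := by
  simp [cycleBlock]

theorem cycleBlock_eq_iff {g : Perm α} {a b : α} :
    cycleBlock g a = cycleBlock g b ↔ g.SameCycle a b := by
  constructor
  · intro h
    have : b ∈ cycleBlock g b := mem_cycleBlock.2 (Equiv.Perm.SameCycle.refl _ _)
    rw [← h] at this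
    exact mem_cycleBlock.1 this
  · intro h
    ext c
    rw [mem_cycleBlock, mem_cycleBlock]
    exact ⟨h.symm.trans, h.trans⟩

/-- The set of orbits of a permutation. -/
def cycleBlocks (g : Perm α) : Finset (Finset α) :=
  Finset.univ.image (cycleBlock g)

/-- The orbits are the supports of the cycle factors together with the fixed points, which account
for the parts equal to 1. -/
theorem parts_partition_eq_map_card (g : Perm α) :
    g.partition.parts = (cycleBlocks g).val.map Finset.card := by
  have hsupp : ∀ a ∈ g.support, cycleBlock g a = (g.cycleOf a).support := by
    intro a ha
    ext b
    rw [mem_cycleBlock, Equiv.Perm.mem_support_cycleOf_iff' (Equiv.Perm.mem_support.1 ha)]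
  have hfix : ∀ a ∉ g.support, cycleBlock g a = {a} := by
    intro a ha
    ext b
    rw [mem_cycleBlock, Finset.mem_singleton]
    exact ⟨fun h => (h.eq_of_left (Equiv.Perm.notMem_support.1 ha)).symm,
      fun h => h ▸ Equiv.Perm.SameCycle.refl _ _⟩
  have hunion : cycleBlocks g = g.cycleFactorsFinset.image Equiv.Perm.support ∪
      (g.support)ᶜ.image fun a => {a} := by
    ext s
    simp only [cycleBlocks, Finset.mem_union, Finset.mem_image, Finset.mem_univ, true_and,
      Finset.mem_compl]
    constructor
    · rintro ⟨a, rfl⟩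
      by_cases ha : a ∈ g.support
      · exact Or.inl ⟨_, Equiv.Perm.cycleOf_mem_cycleFactorsFinset_iff.2 ha, (hsupp a ha).symm⟩
      · exact Or.inr ⟨a, ha, (hfix a ha).symm⟩
    · rintro (⟨c, hc, rfl⟩ | ⟨a, ha, rfl⟩)
      · obtain ⟨a, ha⟩ := (Equiv.Perm.mem_cycleFactorsFinset_iff.1 hc).1.nonempty_support
        have hga := Equiv.Perm.mem_cycleFactorsFinset_support_le hc ha
        exact ⟨a, by rw [hsupp a hga, ← Equiv.Perm.cycle_is_cycleOf ha hc]⟩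
      · exact ⟨a, hfix a ha⟩
  have hdisj : Disjoint (g.cycleFactorsFinset.image Equiv.Perm.support)
      ((g.support)ᶜ.image fun a => ({a} : Finset α)) := by
    rw [Finset.disjoint_left]
    rintro _ hc ha
    obtain ⟨c, hc', rfl⟩ := Finset.mem_image.1 hc
    obtain ⟨a, -, ha⟩ := Finset.mem_image.1 ha
    have := (Equiv.Perm.mem_cycleFactorsFinset_iff.1 hc').1.two_le_card_support
    rw [← ha, Finset.card_singleton] at this
    omega
  have hinj : Set.InjOn Equiv.Perm.support (g.cycleFactorsFinset : Set (Perm α)) := by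
    intro c hc d hd hcd
    by_contra hne
    have h1 := (g.cycleFactorsFinset_pairwise_disjoint hc hd hne).disjoint_support
    rw [hcd, disjoint_self] at h1
    have := (Equiv.Perm.mem_cycleFactorsFinset_iff.1 hd).1.nonempty_support
    rw [h1] at this
    exact absurd this (by simp)
  rw [Equiv.Perm.parts_partition, hunion, ← Finset.disjUnion_eq_union _ _ hdisj,
    Finset.disjUnion_val, Multiset.map_add, Finset.image_val_of_injOn hinj,
    Finset.image_val_of_injOn Finset.singleton_injective.injOn, Multiset.map_map, Multiset.map_map,
    Equiv.Perm.cycleType_def]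
  congr 1
  simp [Finset.card_compl, Multiset.map_const']

omit [Fintype α] [DecidableEq α] in
theorem comp_eq_iff_sameCycle {β : Type*} {g : Perm α} {w : α → β} :
    w ∘ g = w ↔ ∀ a b, g.SameCycle a b → w a = w b := by
  constructor
  · rintro h a b ⟨k, rfl⟩
    have hpow : ∀ (k : ℕ) a, w ((g ^ k) a) = w a := by
      intro k
      induction k with
      | zero => simp
      | succ k ih =>
        intro a
        rw [pow_succ, Equiv.Perm.mul_apply, ih]
        exact congrFun h a
    obtain ⟨k, rfl | rfl⟩ := k.eq_nat_or_neg
    · exact (hpow k a).symm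
    · have := hpow k ((g ^ (-(k : ℤ))) a)
      rw [zpow_neg, zpow_natCast, ← Equiv.Perm.mul_apply, mul_inv_cancel, Equiv.Perm.one_apply] at this
      rw [zpow_neg, zpow_natCast]
      exact this
  · intro h
    funext a
    exact (h a (g a) ⟨1, by simp⟩).symm

/-- A word is fixed by `g` exactly when it is constant on orbits. Choosing one letter per orbit is
expanding the product of the power sums indexed by orbit sizes. -/
theorem psumPart_partition (σ : Type*) [Fintype σ] [DecidableEq σ] (g : Perm α) :
    MvPolynomial.psumPart σ ℂ g.partition =
      ∑ w : α → σ with w ∘ ⇑g = w, ∏ a, MvPolynomial.X (w a) := by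
  classical
  let blk : α → cycleBlocks g := fun a => ⟨cycleBlock g a, Finset.mem_image_of_mem _ (Finset.mem_univ a)⟩
  have hblk : ∀ s : cycleBlocks g, ∃ a, blk a = s := by
    rintro ⟨s, hs⟩
    obtain ⟨a, -, rfl⟩ := Finset.mem_image.1 hs
    exact ⟨a, rfl⟩
  choose rep hrep using hblk
  have hblk_iff : ∀ a b, blk a = blk b ↔ g.SameCycle a b := fun a b =>
    Subtype.ext_iff.trans cycleBlock_eq_iff
  have hfib : ∀ s : cycleBlocks g, (Finset.univ.filter fun a => blk a = s).card = s.1.card := by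
    intro s
    congr 1
    ext a
    rw [← hrep s]
    simp only [Finset.mem_filter, Finset.mem_univ, true_and, hblk_iff]
    change _ ↔ a ∈ cycleBlock g _
    rw [mem_cycleBlock]
    exact ⟨fun h => h.symm, fun h => h.symm⟩
  have hsum : ∑ w : α → σ with w ∘ ⇑g = w, ∏ a, (MvPolynomial.X (w a) : MvPolynomial σ ℂ) =
      ∑ v : cycleBlocks g → σ, ∏ a, MvPolynomial.X (v (blk a)) := by
    refine Finset.sum_bij' (fun w _ s => w (rep s)) (fun v _ a => v (blk a)) ?_ ?_ ?_ ?_ ?_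
    · simp
    · intro v _
      simp only [Finset.mem_filter, Finset.mem_univ, true_and, comp_eq_iff_sameCycle]
      intro a b hab
      rw [(hblk_iff a b).2 hab]
    · intro w hw
      simp only [Finset.mem_filter, Finset.mem_univ, true_and, comp_eq_iff_sameCycle] at hw
      funext a
      exact hw _ _ ((hblk_iff _ _).1 (hrep _))
    · intro v _
      funext s
      exact congrArg v (hrep s)
    · intro w hw
      simp only [Finset.mem_filter, Finset.mem_univ, true_and, comp_eq_iff_sameCycle] at hw
      refine Finset.prod_congr rfl fun a _ => ?_
      rw [hw a (rep (blk a)) ((hblk_iff _ _).1 (hrep _).symm)]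
  have hprod : ∀ v : cycleBlocks g → σ, ∏ a, (MvPolynomial.X (v (blk a)) : MvPolynomial σ ℂ) =
      ∏ s : cycleBlocks g, MvPolynomial.X (v s) ^ s.1.card := by
    intro v
    rw [← Finset.prod_fiberwise_of_maps_to (g := blk) (t := Finset.univ) (fun _ _ => Finset.mem_univ _)]
    refine Finset.prod_congr rfl fun s _ => ?_
    rw [← hfib s, ← Finset.prod_const]
    refine Finset.prod_congr rfl fun a ha => ?_
    rw [(Finset.mem_filter.1 ha).2]
  rw [hsum, Finset.sum_congr rfl fun v _ => hprod v, MvPolynomial.psumPart,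
    parts_partition_eq_map_card, Multiset.map_map]
  change ∏ s ∈ cycleBlocks g, MvPolynomial.psum σ ℂ s.card = _
  rw [← Finset.prod_coe_sort]
  simp only [MvPolynomial.psum]
  rw [Finset.prod_univ_sum, Fintype.piFinset_univ]

end Cycles

/-! ### The Frobenius characteristic of class functions -/

section Frobenius

variable {n : ℕ}

/-- The Frobenius characteristic of a complex function on the symmetric group. -/
noncomputable def frobeniusFun (χ : Perm (Fin n) → ℂ) : MvPolynomial (Fin n) ℂ :=
  ((n.factorial : ℂ)⁻¹) • ∑ g : Perm (Fin n), χ g • MvPolynomial.psumPart (Fin n) ℂ g.partition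

theorem frobeniusFun_character {V : Type*} [AddCommGroup V] [Module ℂ V]
    (ρ : Representation ℂ (Perm (Fin n)) V) : frobeniusFun ρ.character = frobeniusChar ρ :=
  rfl

theorem frobeniusFun_sub (χ ψ : Perm (Fin n) → ℂ) :
    frobeniusFun (χ - ψ) = frobeniusFun χ - frobeniusFun ψ := by
  simp [frobeniusFun, sub_smul, Finset.sum_sub_distrib, smul_sub]

theorem frobeniusFun_sum {ι : Type*} (s : Finset ι) (c : ι → ℂ) (χ : ι → Perm (Fin n) → ℂ) :
    frobeniusFun (fun g => ∑ i ∈ s, c i * χ i g) = ∑ i ∈ s, c i • frobeniusFun (χ i) := by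
  simp only [frobeniusFun, Finset.sum_smul, Finset.smul_sum, mul_smul]
  rw [Finset.sum_comm]
  exact Finset.sum_congr rfl fun i _ => Finset.sum_congr rfl fun g _ => smul_comm _ _ _

theorem sum_smul_psumPart (χ : Perm (Fin n) → ℂ) :
    ∑ g : Perm (Fin n), χ g • MvPolynomial.psumPart (Fin n) ℂ g.partition =
      ∑ w : Fin n → Fin n, stabSum χ w • ∏ a, MvPolynomial.X (w a) := by
  simp only [psumPart_partition, stabSum, Finset.smul_sum, Finset.sum_smul, Finset.sum_filter]
  rw [Finset.sum_comm]
  exact Finset.sum_congr rfl fun w _ => Finset.sum_congr rfl fun g _ => by split_ifs <;> simp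

theorem prod_X_eq_monomial {α σ : Type*} [Fintype α] (w : α → σ) :
    ∏ a, (MvPolynomial.X (w a) : MvPolynomial σ ℂ) =
      MvPolynomial.monomial (∑ a, Finsupp.single (w a) 1) 1 := by
  simp [MvPolynomial.X, MvPolynomial.monomial_sum_one]

theorem exists_perm_comp_iff_sum_single {α σ : Type*} [Fintype α] [DecidableEq α] [DecidableEq σ]
    {v w : α → σ} : (∃ h : Perm α, v = w ∘ h) ↔
      ∑ a, Finsupp.single (v a) 1 = ∑ a, (Finsupp.single (w a) 1 : σ →₀ ℕ) := by
  have hc : ∀ (v : α → σ) b, (∑ a, (Finsupp.single (v a) 1 : σ →₀ ℕ)) b =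
      Fintype.card {a // v a = b} := by
    intro v b
    rw [Finsupp.finsetSum_apply, Fintype.card_subtype, Finset.card_filter]
    exact Finset.sum_congr rfl fun a _ => Finsupp.single_apply
  rw [exists_perm_comp_iff, Finsupp.ext_iff]
  simp only [hc]

/-- A class function with vanishing Frobenius characteristic has vanishing sums over all Young
subgroups. -/
theorem stabSum_eq_zero_of_frobeniusFun {χ : Perm (Fin n) → ℂ}
    (hχ : ∀ g h, χ (h * g * h⁻¹) = χ g) (h0 : frobeniusFun χ = 0) (v : Fin n → Fin n) :
    stabSum χ v = 0 := by
  classical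
  have hfac : ((n.factorial : ℂ)⁻¹) ≠ 0 := inv_ne_zero (Nat.cast_ne_zero.2 (Nat.factorial_ne_zero _))
  have h1 : ∑ w : Fin n → Fin n, stabSum χ w • ∏ a, (MvPolynomial.X (w a) : MvPolynomial _ ℂ) = 0 := by
    rw [← sum_smul_psumPart]
    exact (smul_eq_zero.1 h0).resolve_left hfac
  -- The words with the same monomial as `v` are its rearrangements, and all of these have the same
  -- stabilizer sum up to conjugation.
  have h2 := congrArg (MvPolynomial.coeff (∑ a, Finsupp.single (v a) 1)) h1
  simp only [MvPolynomial.coeff_sum, MvPolynomial.coeff_smul, prod_X_eq_monomial,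
    MvPolynomial.coeff_monomial, MvPolynomial.coeff_zero, smul_eq_mul, mul_ite, mul_one,
    mul_zero, ← exists_perm_comp_iff_sum_single] at h2
  have h3 := sum_stabSum hχ v
  rw [Finset.sum_filter, h2, mul_zero, zero_eq_mul] at h3
  refine h3.resolve_left (inv_ne_zero ?_)
  rw [stabSum, Finset.sum_const, nsmul_eq_mul, mul_one, Nat.cast_ne_zero]
  exact Finset.card_ne_zero_of_mem (a := 1) (by simp)

/-- A class function on the symmetric group is determined by its Frobenius characteristic. -/
theorem eq_zero_of_frobeniusFun {χ : Perm (Fin n) → ℂ}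
    (hχ : ∀ g h, χ (h * g * h⁻¹) = χ g) (h0 : frobeniusFun χ = 0) : χ = 0 := by
  classical
  by_contra hne
  obtain ⟨g₀, hg₀⟩ := Function.ne_iff.1 hne
  -- Take `g` with χ(g) ≠ 0 and cycle partition of least rank, and let `v` label its cycles. A
  -- permutation fixing `v` has a finer cycle partition: if strictly finer, χ vanishes by
  -- minimality; if equal, it is conjugate to `g`. The stabilizer sum is thus a positive multiple of
  -- χ(g).
  obtain ⟨g, hg, hmin⟩ := Set.exists_min_image {g | χ g ≠ 0}
    (fun g => partitionRank (Equiv.Perm.SameCycle.setoid g)) (Set.toFinite _) ⟨g₀, hg₀⟩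
  let v : Fin n → Fin n := fun a => (Quotient.mk (Equiv.Perm.SameCycle.setoid g) a).out
  have hv : ∀ a b, v a = v b ↔ g.SameCycle a b := by
    intro a b
    constructor
    · exact fun h => Quotient.exact (Quotient.out_injective h)
    · exact fun h => congrArg Quotient.out (Quotient.sound (s := Equiv.Perm.SameCycle.setoid g) h)
  have hterm : ∀ h ∈ Finset.univ.filter fun h : Perm (Fin n) => v ∘ h = v, χ h =
      if Equiv.Perm.SameCycle.setoid h = Equiv.Perm.SameCycle.setoid g then χ g else 0 := by
    intro h hh
    have hle : Equiv.Perm.SameCycle.setoid h ≤ Equiv.Perm.SameCycle.setoid g := fun a b hab =>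
      (hv a b).1 (comp_eq_iff_sameCycle.1 (Finset.mem_filter.1 hh).2 a b hab)
    split_ifs with heq
    · have hblock : cycleBlock h = cycleBlock g := by
        funext a
        ext b
        rw [mem_cycleBlock, mem_cycleBlock]
        exact Setoid.ext_iff.1 heq a b
      have hconj : IsConj g h := by
        rw [Equiv.Perm.partition_eq_of_isConj]
        ext1
        rw [parts_partition_eq_map_card, parts_partition_eq_map_card, cycleBlocks, cycleBlocks,
          hblock]
      obtain ⟨c, rfl⟩ := isConj_iff.1 hconj
      exact hχ g c
    · by_contra hne
      exact (partitionRank_strictMono (lt_of_le_of_ne hle heq)).not_ge (hmin h hne)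
  have hsum := stabSum_eq_zero_of_frobeniusFun hχ h0 v
  rw [stabSum, Finset.sum_congr rfl hterm, ← Finset.sum_filter, Finset.sum_const, nsmul_eq_mul,
    mul_eq_zero, Nat.cast_eq_zero] at hsum
  refine hsum.elim (Finset.card_ne_zero_of_mem (a := g) ?_) hg
  simp only [Finset.mem_filter, Finset.mem_univ, true_and, and_true]
  exact comp_eq_iff_sameCycle.2 fun a b hab => (hv a b).2 hab

/-- The permutation character on words in `p` letters with prescribed letter multiplicities. -/
def wordChar {p : ℕ} (n : ℕ) (z : Fin p → ℤ) (g : Perm (Fin n)) : ℂ :=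
  ((Finset.univ.filter fun u : Fin n → Fin p =>
    (∀ i, (Fintype.card {a // u a = i} : ℤ) = z i) ∧ u ∘ g = u).card : ℂ)

theorem sum_wordChar_mul {p : ℕ} (z : Fin p → ℤ) (χ : Perm (Fin n) → ℂ) :
    ∑ g, wordChar n z g * χ g =
      ∑ u ∈ Finset.univ.filter fun u : Fin n → Fin p =>
        ∀ i, (Fintype.card {a // u a = i} : ℤ) = z i, stabSum χ u := by
  simp only [wordChar, stabSum, Finset.card_filter, Nat.cast_sum, Finset.sum_mul,
    Finset.sum_filter, Nat.cast_ite, Nat.cast_one, Nat.cast_zero, ite_mul, one_mul, zero_mul]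
  rw [Finset.sum_comm]
  refine Finset.sum_congr rfl fun u _ => ?_
  by_cases h : ∀ i, (Fintype.card {a // u a = i} : ℤ) = z i
  · simp [h]
  · simp only [h, false_and, if_false, Finset.sum_const_zero]

end Frobenius

/-! ### Products of complete homogeneous symmetric functions -/

section CompleteHomogeneous

variable {n : ℕ}

/-- The multiset of letters of a word. -/
def wordSym {τ : Type*} (v : Fin n → τ) : Sym τ n :=
  ⟨Finset.univ.val.map v, by simp⟩

theorem wordSym_surjective {τ : Type*} : Function.Surjective (wordSym : (Fin n → τ) → Sym τ n) := by
  rintro ⟨s, hs⟩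
  induction s using Quotient.inductionOn with
  | h l =>
    have hl : l.length = n := hs
    subst hl
    refine ⟨l.get, Subtype.ext ?_⟩
    simp [wordSym, Fin.univ_val_map]

/-- Multisets are the rearrangement classes of words, and each class has total weight n! by
orbit–stabilizer. -/
theorem sum_stabSum_smul_wordSym {τ A : Type*} [Fintype τ] [DecidableEq τ] [AddCommGroup A]
    [Module ℂ A] (F : Sym τ n → A) :
    ∑ v : Fin n → τ, stabSum (fun _ => 1) v • F (wordSym v) = (n.factorial : ℂ) • ∑ s, F s := by
  classical
  rw [← Finset.sum_fiberwise_of_maps_to (g := wordSym) (t := Finset.univ)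
    (fun _ _ => Finset.mem_univ _), Finset.smul_sum]
  refine Finset.sum_congr rfl fun s _ => ?_
  obtain ⟨v, rfl⟩ := wordSym_surjective s
  have h1 := sum_stabSum_one v
  rw [Fintype.card_fin] at h1
  rw [← h1, Finset.sum_smul]
  refine Finset.sum_congr ?_ fun w hw => ?_
  · ext w
    simp only [Finset.mem_filter, Finset.mem_univ, true_and, exists_perm_comp_iff_map]
    exact Subtype.ext_iff
  · have : wordSym w = wordSym v := Subtype.ext (exists_perm_comp_iff_map.1 (Finset.mem_filter.1 hw).2)
    rw [this]

theorem count_map_mk {ι σ : Type*} [DecidableEq ι] (i j : ι) (t : Multiset σ) :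
    ((t.map (Prod.mk j)).filter fun x => x.1 = i).map Prod.snd = if j = i then t else 0 := by
  rw [Multiset.filter_map, Multiset.map_map]
  split_ifs with h
  · subst h
    simp
  · simp [h]

theorem sum_map_mk_filter {ι σ : Type*} [Fintype ι] [DecidableEq ι] (s : Multiset (ι × σ)) :
    ∑ i, ((s.filter fun x => x.1 = i).map Prod.snd).map (Prod.mk i) = s := by
  induction s using Multiset.induction_on with
  | empty => simp
  | cons a s ih =>
    conv_rhs => rw [← ih]
    have h : ∀ i, (((a ::ₘ s).filter fun x => x.1 = i).map Prod.snd).map (Prod.mk i) =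
        (if a.1 = i then {a} else 0) +
          ((s.filter fun x => x.1 = i).map Prod.snd).map (Prod.mk i) := by
      intro i
      by_cases hi : a.1 = i
      · subst hi
        simp
      · simp [hi]
    rw [Finset.sum_congr rfl fun i _ => h i, Finset.sum_add_distrib]
    simp

/-- A multiset of pairs is the same as a family of multisets of second coordinates indexed by the
first coordinate. -/
theorem prod_hsymm_eq_sum {σ : Type} [Fintype σ] [DecidableEq σ] {p : ℕ} (r : Fin p → ℕ)
    (hr : ∑ i, r i = n) :
    ∏ i, MvPolynomial.hsymm σ ℂ (r i) =
      ∑ s ∈ Finset.univ.filter fun s : Sym (Fin p × σ) n =>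
        ∀ i, ((s : Multiset (Fin p × σ)).map Prod.fst).count i = r i,
        (((s : Multiset (Fin p × σ)).map Prod.snd).map MvPolynomial.X).prod := by
  classical
  have hcount : ∀ (s : Multiset (Fin p × σ)) i,
      (s.map Prod.fst).count i = ((s.filter fun x => x.1 = i).map Prod.snd).card := by
    intro s i
    rw [Multiset.count_map, Multiset.card_map]
    simp only [eq_comm]
  have hfilter : ∀ (t : ∀ i, Sym σ (r i)) i,
      ((∑ j, (t j : Multiset σ).map (Prod.mk j)).filter fun x : Fin p × σ => x.1 = i).map Prod.snd =
        (t i : Multiset σ) := by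
    intro t i
    have h1 := map_sum (Multiset.mapAddMonoidHom (Prod.snd : Fin p × σ → σ) |>.comp
      ⟨⟨Multiset.filter fun x : Fin p × σ => x.1 = i, by simp⟩, Multiset.filter_add _⟩)
      (fun j => (t j : Multiset σ).map (Prod.mk j)) Finset.univ
    refine h1.trans ?_
    refine (Finset.sum_congr rfl fun j _ => count_map_mk i j (t j : Multiset σ)).trans ?_
    simp
  simp only [MvPolynomial.hsymm]
  rw [Finset.prod_univ_sum, Fintype.piFinset_univ]
  symm
  refine Finset.sum_bij' (fun s hs i => ⟨((s : Multiset (Fin p × σ)).filter fun x => x.1 = i).map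
      Prod.snd, by rw [← hcount]; exact (Finset.mem_filter.1 hs).2 i⟩)
    (fun t _ => ⟨∑ i, (t i : Multiset σ).map (Prod.mk i), ?_⟩) ?_ ?_ ?_ ?_ ?_
  · rw [Multiset.card_sum]
    simp [hr]
  · exact fun _ _ => Finset.mem_univ _
  · intro t _
    refine Finset.mem_filter.2 ⟨Finset.mem_univ _, fun i => ?_⟩
    change Multiset.count i (Multiset.map Prod.fst (∑ i, (t i : Multiset σ).map (Prod.mk i))) = _
    rw [hcount, hfilter]
    simp
  · intro s _
    exact Subtype.ext (sum_map_mk_filter s.1)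
  · intro t _
    funext i
    exact Subtype.ext (hfilter t i)
  · intro s _
    change _ = ∏ i, ((((s : Multiset (Fin p × σ)).filter fun x => x.1 = i).map Prod.snd).map
      MvPolynomial.X).prod
    conv_lhs => rw [← sum_map_mk_filter (s : Multiset (Fin p × σ))]
    rw [Multiset.map_map]
    refine (congrArg Multiset.prod (map_sum (Multiset.mapAddMonoidHom _) _ _)).trans ?_
    rw [Multiset.prod_sum]
    refine Finset.prod_congr rfl fun i _ => ?_
    simp

/-- With a negative index both sides vanish, since a count is nonnegative. Allowing this case lets
every term of a Jacobi–Trudi expansion be treated alike. -/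
theorem prod_hInt_eq_sum {σ : Type} [Fintype σ] [DecidableEq σ] {p : ℕ} (z : Fin p → ℤ)
    (hz : ∑ i, z i = n) :
    ∏ i, hInt σ (z i) =
      ∑ s : Sym (Fin p × σ) n,
        if ∀ i, (((s : Multiset (Fin p × σ)).map Prod.fst).count i : ℤ) = z i then
          (((s : Multiset (Fin p × σ)).map Prod.snd).map MvPolynomial.X).prod else 0 := by
  by_cases hneg : ∀ i, 0 ≤ z i
  · obtain ⟨r, rfl⟩ : ∃ r : Fin p → ℕ, z = fun i => (r i : ℤ) :=
      ⟨fun i => (z i).toNat, funext fun i => (Int.toNat_of_nonneg (hneg i)).symm⟩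
    simp only [hInt, Int.natCast_nonneg, if_true, Int.toNat_natCast, Nat.cast_inj]
    rw [prod_hsymm_eq_sum (n := n) r (by beta_reduce at hz; exact_mod_cast hz), Finset.sum_filter]
  · push Not at hneg
    obtain ⟨i, hi⟩ := hneg
    rw [Finset.prod_eq_zero (Finset.mem_univ i) (by simp [hInt, hi.not_ge]), Finset.sum_eq_zero]
    intro s _
    refine if_neg fun h => ?_
    have := h i
    omega

/-- The Frobenius characteristic of a permutation representation on words is a product of complete
homogeneous symmetric functions. -/
theorem frobeniusFun_wordChar {p : ℕ} (z : Fin p → ℤ) (hz : ∑ i, z i = n) :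
    frobeniusFun (wordChar n z) = ∏ i, hInt (Fin n) (z i) := by
  classical
  have hfac : (n.factorial : ℂ) ≠ 0 := Nat.cast_ne_zero.2 (Nat.factorial_ne_zero _)
  rw [frobeniusFun, inv_smul_eq_iff₀ hfac, prod_hInt_eq_sum z hz, ← sum_stabSum_smul_wordSym,
    sum_smul_psumPart, ← (Equiv.arrowProdEquivProdArrow (Fin n) (fun _ => Fin p)
      (fun _ => Fin n)).symm.sum_comp, Fintype.sum_prod_type, Finset.sum_comm]
  refine Finset.sum_congr rfl fun w _ => ?_
  -- A permutation fixing both `u` and `w` is one fixing the word of pairs, so the sum becomes one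
  -- over words in `Fin p × Fin n`.
  have hword : stabSum (wordChar n z) w = ∑ u : Fin n → Fin p,
      if ∀ i, (Fintype.card {a // u a = i} : ℤ) = z i then
        stabSum (fun _ => 1) (fun a => (u a, w a)) else 0 := by
    simp only [stabSum, wordChar, Finset.card_filter, Nat.cast_sum, Finset.sum_filter,
      Nat.cast_ite, Nat.cast_one, Nat.cast_zero]
    rw [← Finset.sum_filter, Finset.sum_comm]
    refine Finset.sum_congr rfl fun u _ => ?_
    by_cases h : ∀ i, (Fintype.card {a // u a = i} : ℤ) = z i
    · simp only [h, implies_true, true_and, if_true]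
      rw [Finset.sum_filter]
      refine Finset.sum_congr rfl fun g _ => ?_
      simp only [funext_iff, Function.comp_apply, Prod.mk.injEq, forall_and]
      by_cases h1 : ∀ x, w (g x) = w x <;> simp [h1]
    · simp only [h, false_and, if_false, Finset.sum_const_zero]
  rw [hword, Finset.sum_smul]
  refine Finset.sum_congr rfl fun u _ => ?_
  change _ = stabSum (fun _ => 1) (fun a => (u a, w a)) • _
  have h1 : ∀ i, ((wordSym fun a => (u a, w a) : Multiset (Fin p × Fin n)).map Prod.fst).count i =
      Fintype.card {a // u a = i} := by
    intro i
    change ((Finset.univ.val.map fun a => (u a, w a)).map Prod.fst).count i = _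
    rw [Multiset.map_map, Multiset.count_map, Fintype.card_subtype]
    simp only [Function.comp_apply, eq_comm]
    rfl
  have h2 : (((wordSym fun a => (u a, w a) : Multiset (Fin p × Fin n)).map Prod.snd).map
      (MvPolynomial.X : Fin n → MvPolynomial (Fin n) ℂ)).prod = ∏ a, MvPolynomial.X (w a) := by
    change (((Finset.univ.val.map fun a => (u a, w a)).map Prod.snd).map _).prod = _
    rw [Multiset.map_map, Multiset.map_map]
    rfl
  have h3 : (Equiv.arrowProdEquivProdArrow (Fin n) (fun _ => Fin p) (fun _ => Fin n)).symm (u, w) =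
      fun a => (u a, w a) := rfl
  rw [h3]
  simp only [h1]
  rw [h2]
  split_ifs <;> simp

end CompleteHomogeneous

/-! ### Pairing with word characters and skewing -/

section Pairing

variable {l m q : ℕ}

theorem youngHom_injective : Function.Injective (youngHom l m) := by
  intro p p' h
  have h' : ∀ a, youngHom l m p a = youngHom l m p' a := fun a => by rw [h]
  refine Prod.ext (Equiv.ext fun i => ?_) (Equiv.ext fun i => ?_)
  · have := h' (Fin.castAdd m i)
    rw [youngHom_castAdd, youngHom_castAdd] at this
    exact Fin.castAdd_injective _ _ this
  · have := h' (Fin.natAdd l i)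
    rw [youngHom_natAdd, youngHom_natAdd] at this
    exact Fin.natAdd_injective _ _ this

theorem exists_youngHom_eq {g : Perm (Fin (l + m))}
    (h : ∀ i : Fin l, (g (Fin.castAdd m i) : ℕ) < l) : ∃ p, youngHom l m p = g := by
  have hmaps : Set.MapsTo (finSumFinEquiv.symm.permCongr g)
      (Set.range (Sum.inl : Fin l → Fin l ⊕ Fin m)) (Set.range Sum.inl) := by
    rintro _ ⟨i, rfl⟩
    refine ⟨⟨_, h i⟩, ?_⟩
    rw [← finSumFinEquiv.injective.eq_iff]
    simp [Equiv.permCongr_apply]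
  obtain ⟨p, hp⟩ := Equiv.Perm.mem_sumCongrHom_range_of_perm_mapsTo_inl hmaps
  refine ⟨p, ?_⟩
  have : youngHom l m p = finSumFinEquiv.permCongr (finSumFinEquiv.symm.permCongr g) := by
    rw [← hp]
    rfl
  rw [this]
  ext a
  simp [Equiv.permCongr_apply]

/-- The operator `N` sends everything into the invariants and acts on them as m! times `h`, so its
trace can be computed on the invariants alone. -/
theorem character_skewRow {V : Type*} [AddCommGroup V] [Module ℂ V] [FiniteDimensional ℂ V]
    (ρ : Representation ℂ (Perm (Fin (l + m))) V) (h : Perm (Fin l)) :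
    ((m.factorial : ℕ) : ℂ) * (skewRow ρ).character h =
      ∑ k : Perm (Fin m), ρ.character (youngHom l m (h, k)) := by
  let N : V →ₗ[ℂ] V := ∑ k : Perm (Fin m), ρ (youngHom l m (h, k))
  have hN : ∀ v, N v = ∑ k : Perm (Fin m), ρ (youngHom l m (h, k)) v := fun v =>
    LinearMap.sum_apply _ _ _
  have hmul : ∀ (k k' : Perm (Fin m)) v, ρ (youngHom l m (1, k')) (ρ (youngHom l m (h, k)) v) =
      ρ (youngHom l m (h, k' * k)) v := by
    intro k k' v
    rw [← Module.End.mul_apply, ← map_mul, ← map_mul, Prod.mk_mul_mk, one_mul]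
  have hmul' : ∀ (k : Perm (Fin m)) v, ρ (youngHom l m (h, k)) v =
      ρ (youngHom l m (h, 1)) (ρ (youngHom l m (1, k)) v) := by
    intro k v
    rw [← Module.End.mul_apply, ← map_mul, ← map_mul, Prod.mk_mul_mk, one_mul, mul_one]
  have hmem : ∀ v, N v ∈ skewSpace ρ := by
    intro v g
    change ρ (youngHom l m (1, g)) (N v) = N v
    rw [hN, map_sum]
    simp only [hmul]
    exact Fintype.sum_equiv (Equiv.mulLeft g) _ _ fun k => rfl
  have hrestrict : N.restrict (p := skewSpace ρ) (q := skewSpace ρ) (fun v _ => hmem v) =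
      (m.factorial : ℂ) • skewRow ρ h := by
    ext v
    change N v = (m.factorial : ℂ) • ρ (youngHom l m (h, 1)) v
    have hv : ∀ k : Perm (Fin m), ρ (youngHom l m (h, k)) v = ρ (youngHom l m (h, 1)) v := fun k => by
      rw [hmul', show ρ (youngHom l m (1, k)) v = v from v.2 k]
    rw [hN, Finset.sum_congr rfl fun k _ => hv k, Finset.sum_const, Finset.card_univ,
      Fintype.card_perm, Fintype.card_fin, Nat.cast_smul_eq_nsmul]
  have htrace := LinearMap.trace_restrict_eq_of_forall_mem (skewSpace ρ) N hmem
  rw [hrestrict, map_smul, smul_eq_mul] at htrace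
  refine htrace.trans ?_
  rw [map_sum]
  rfl

/-- The word which is `v` on the first `l` points, with letters shifted, and constantly `0` on the
last `m` points. -/
def extendWord (m : ℕ) (v : Fin l → Fin q) : Fin (l + m) → Fin (q + 1) :=
  Fin.addCases (fun i => (v i).succ) fun _ => 0

@[simp]
theorem extendWord_castAdd (v : Fin l → Fin q) (i : Fin l) :
    extendWord m v (Fin.castAdd m i) = (v i).succ :=
  Fin.addCases_left _

@[simp]
theorem extendWord_natAdd (v : Fin l → Fin q) (i : Fin m) : extendWord m v (Fin.natAdd l i) = 0 :=
  Fin.addCases_right _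

theorem card_extendWord (v : Fin l → Fin q) (i : Fin (q + 1)) :
    (Fintype.card {a // extendWord m v a = i} : ℤ) =
      Fin.cons (α := fun _ => ℤ) (m : ℤ) (fun j => (Fintype.card {a // v a = j} : ℤ)) i := by
  rw [Fintype.card_subtype, Finset.card_filter, Fin.sum_univ_add]
  refine Fin.cases ?_ (fun j => ?_) i
  · simp [Fin.succ_ne_zero]
  · simp [Fin.succ_inj, (Fin.succ_ne_zero _).symm, Fintype.card_subtype]

/-- The letter 0 occurs exactly on the last m points, so the stabilizer lies in the Young subgroup
and is the product of the stabilizer of `v` with S_m. -/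
theorem stabSum_extendWord (χ : Perm (Fin (l + m)) → ℂ) (v : Fin l → Fin q) :
    stabSum χ (extendWord m v) =
      stabSum (fun h => ∑ k : Perm (Fin m), χ (youngHom l m (h, k))) v := by
  unfold stabSum
  rw [← Finset.sum_product' _ _ fun h k => χ (youngHom l m (h, k))]
  symm
  refine Finset.sum_bij (fun p _ => youngHom l m p) ?_ (fun _ _ _ _ h => youngHom_injective h) ?_
    fun _ _ => rfl
  · rintro ⟨h, k⟩ hp
    have hv := (Finset.mem_filter.1 (Finset.mem_product.1 hp).1).2
    refine Finset.mem_filter.2 ⟨Finset.mem_univ _, funext fun a => ?_⟩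
    refine Fin.addCases (fun i => ?_) (fun i => ?_) a
    · simpa using congrFun hv i
    · simp
  · intro g hg
    have hg' := congrFun (Finset.mem_filter.1 hg).2
    obtain ⟨p, rfl⟩ := exists_youngHom_eq (g := g) (by
      intro i
      by_contra hlt
      obtain ⟨j, hj⟩ : ∃ j, g (Fin.castAdd m i) = Fin.natAdd l j :=
        ⟨⟨g (Fin.castAdd m i) - l, by omega⟩, Fin.ext (by simp; omega)⟩
      have := hg' (Fin.castAdd m i)
      rw [Function.comp_apply, hj, extendWord_natAdd, extendWord_castAdd] at this
      exact (Fin.succ_ne_zero _).symm this)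
    refine ⟨p, Finset.mem_product.2 ⟨Finset.mem_filter.2 ⟨Finset.mem_univ _, funext fun i => ?_⟩,
      Finset.mem_univ _⟩, rfl⟩
    simpa using hg' (Fin.castAdd m i)

theorem sum_wordChar_mul_of_word {n p : ℕ} {χ : Perm (Fin n) → ℂ}
    (hχ : ∀ g h, χ (h * g * h⁻¹) = χ g) (v : Fin n → Fin p) (z : Fin p → ℤ)
    (hz : ∀ i, (Fintype.card {a // v a = i} : ℤ) = z i) :
    (n.factorial : ℂ)⁻¹ * ∑ g, wordChar n z g * χ g =
      (stabSum (fun _ => 1) v)⁻¹ * stabSum χ v := by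
  have h := sum_stabSum hχ v
  rw [Fintype.card_fin] at h
  rw [← h, sum_wordChar_mul]
  congr 2
  ext u
  simp only [Finset.mem_filter, Finset.mem_univ, true_and, exists_perm_comp_iff]
  refine forall_congr' fun i => ?_
  rw [← hz i, Nat.cast_inj]

theorem exists_word (r : Fin q → ℕ) :
    ∃ v : Fin (∑ i, r i) → Fin q, ∀ i, Fintype.card {a // v a = i} = r i := by
  refine ⟨fun a => (finSigmaFinEquiv.symm a).1, fun i => ?_⟩
  rw [Fintype.card_congr (finSigmaFinEquiv.symm.subtypeEquiv (q := fun s => s.1 = i) fun a => Iff.rfl),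
    Fintype.card_congr (Equiv.sigmaSubtype i), Fintype.card_fin]

/-- Pairing with the character on words with letter multiplicities `m, r_1, r_2, …` amounts to
pairing the skewed representation with the character on words with multiplicities `r_1, r_2, …`. -/
theorem sum_wordChar_cons_mul_character {V : Type*} [AddCommGroup V] [Module ℂ V]
    [FiniteDimensional ℂ V] (ρ : Representation ℂ (Perm (Fin (l + m))) V) (r : Fin q → ℕ)
    (hr : ∑ i, r i = l) :
    (((l + m).factorial : ℕ) : ℂ)⁻¹ *
        ∑ g, wordChar (l + m) (Fin.cons (α := fun _ => ℤ) (m : ℤ) fun i => (r i : ℤ)) g *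
          ρ.character g =
      ((l.factorial : ℕ) : ℂ)⁻¹ *
        ∑ h, wordChar l (fun i => (r i : ℤ)) h * (skewRow ρ).character h := by
  subst hr
  obtain ⟨v, hv⟩ := exists_word r
  rw [sum_wordChar_mul_of_word (fun g h => ρ.char_conj g h) (extendWord m v) _ (fun i => by
      rw [card_extendWord]; simp only [hv]),
    sum_wordChar_mul_of_word (fun g h => (skewRow ρ).char_conj g h) v _ (fun i => by rw [hv]),
    stabSum_extendWord, stabSum_extendWord]
  have h1 : stabSum (fun h => ∑ k : Perm (Fin m), ρ.character (youngHom _ m (h, k))) v =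
      (m.factorial : ℂ) * stabSum (skewRow ρ).character v := by
    simp only [← character_skewRow, stabSum, Finset.mul_sum]
  have h2 : stabSum (fun _ => ∑ _k : Perm (Fin m), (1 : ℂ)) v =
      (m.factorial : ℂ) * stabSum (fun _ => 1) v := by
    simp only [stabSum, Finset.mul_sum]
    simp [Fintype.card_perm]
  have hm : (m.factorial : ℂ) ≠ 0 := Nat.cast_ne_zero.2 (Nat.factorial_ne_zero _)
  rw [h1, h2, mul_inv, mul_mul_mul_comm, inv_mul_cancel₀ hm, one_mul]

end Pairing

/-! ### Prescribing the values of complete homogeneous symmetric functions -/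

section Prescribe

theorem powerSeries_geom_mul (c : ℂ) :
    PowerSeries.mk (fun k => c ^ k) * (1 - PowerSeries.C c * PowerSeries.X) = 1 := by
  ext k
  rw [mul_sub, mul_one, map_sub, mul_left_comm, PowerSeries.coeff_C_mul]
  cases k with
  | zero => simp
  | succ k => simp [PowerSeries.coeff_succ_mul_X, PowerSeries.coeff_one, pow_succ']

theorem mk_eval_hsymm {n : ℕ} (x : Fin n → ℂ) :
    PowerSeries.mk (fun r => MvPolynomial.eval x (MvPolynomial.hsymm (Fin n) ℂ r)) =
      ∏ i, PowerSeries.mk fun k => x i ^ k := by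
  ext r
  rw [PowerSeries.coeff_mk, PowerSeries.coeff_prod, MvPolynomial.hsymm, map_sum]
  refine Finset.sum_bij' (fun s _ => Multiset.toFinsupp (s : Multiset (Fin n)))
    (fun f hf => ⟨Finsupp.toMultiset f, ?_⟩) ?_ ?_ ?_ ?_ ?_
  · rw [Finsupp.card_toMultiset]
    exact (Finset.mem_finsuppAntidiag'.1 hf).1
  · intro s _
    refine Finset.mem_finsuppAntidiag'.2 ⟨?_, Finset.subset_univ _⟩
    have := Finsupp.card_toMultiset (Multiset.toFinsupp (s : Multiset (Fin n)))
    rw [Multiset.toFinsupp_toMultiset] at this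
    exact this.symm.trans s.2
  · exact fun _ _ => Finset.mem_univ _
  · intro s _
    exact Subtype.ext (Multiset.toFinsupp_toMultiset _)
  · intro f _
    exact Finsupp.toMultiset_toFinsupp f
  · intro s _
    rw [map_multiset_prod, Multiset.map_map, Finset.prod_multiset_map_count]
    rw [Finset.prod_subset (Finset.subset_univ _)]
    · simp [PowerSeries.coeff_mk]
    · intro i _ hi
      rw [Multiset.count_eq_zero.2 (by simpa using hi), pow_zero]

/-- Constant term 1 excludes the root 0, so each linear factor can be rescaled; evaluation at 0
shows that the leftover constant is 1. -/
theorem polynomial_eq_prod_one_sub {P : Polynomial ℂ} (hP : P.coeff 0 = 1) :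
    P = (P.roots.map fun a => 1 - Polynomial.C a⁻¹ * Polynomial.X).prod := by
  have hP0 : P ≠ 0 := by
    rintro rfl
    simp at hP
  have hroot : ∀ a ∈ P.roots, a ≠ 0 := by
    rintro a ha rfl
    have := (Polynomial.mem_roots hP0).1 ha
    rw [Polynomial.IsRoot.def, ← Polynomial.coeff_zero_eq_eval_zero, hP] at this
    exact one_ne_zero this
  have h1 : P = Polynomial.C (P.leadingCoeff * (P.roots.map fun a => -a).prod) *
      (P.roots.map fun a => 1 - Polynomial.C a⁻¹ * Polynomial.X).prod := by
    conv_lhs => rw [(IsAlgClosed.splits P).eq_prod_roots]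
    rw [Polynomial.C_mul, mul_assoc, map_multiset_prod, Multiset.map_map, ← Multiset.prod_map_mul]
    congr 2
    refine Multiset.map_congr rfl fun a ha => ?_
    have ha' : Polynomial.C a * Polynomial.C a⁻¹ = 1 := by
      rw [← Polynomial.C_mul, mul_inv_cancel₀ (hroot a ha), Polynomial.C_1]
    simp only [Function.comp_apply, map_neg]
    linear_combination (-Polynomial.X) * ha'
  have h2 : P.leadingCoeff * (P.roots.map fun a => -a).prod = 1 := by
    have := congrArg (Polynomial.eval 0) h1
    rw [← Polynomial.coeff_zero_eq_eval_zero, hP, Polynomial.eval_mul, Polynomial.eval_C,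
      Polynomial.eval_multiset_prod, Multiset.map_map] at this
    simpa using this.symm
  rw [h2, Polynomial.C_1, one_mul] at h1
  exact h1

/-- The complete homogeneous symmetric polynomials of degree at most `n` in `n` variables take
arbitrary complex values. -/
theorem exists_eval_hsymm_eq (n : ℕ) (a : ℕ → ℂ) (ha : a 0 = 1) :
    ∃ x : Fin n → ℂ, ∀ r ≤ n, MvPolynomial.eval x (MvPolynomial.hsymm (Fin n) ℂ r) = a r := by
  -- The generating series of the h_r is the inverse of ∏(1 - x_i t). So the truncation of A⁻¹ in
  -- degree n is factored in this form; the resulting series agrees with A modulo t^(n+1).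
  let A : PowerSeries ℂ := PowerSeries.mk a
  have hA0 : PowerSeries.constantCoeff A ≠ 0 := by simp [A, ha]
  let P : Polynomial ℂ := PowerSeries.trunc (n + 1) A⁻¹
  have hP0 : P.coeff 0 = 1 := by
    simp [P, PowerSeries.coeff_trunc, A, ha]
  have hdeg : P.roots.card ≤ n :=
    (Polynomial.card_roots' P).trans (Nat.lt_succ_iff.1 (PowerSeries.natDegree_trunc_lt _ _))
  -- The truncation may have degree below n; the missing variables are set to 0.
  obtain ⟨x, hx⟩ := wordSym_surjective (n := n)
    (⟨P.roots.map (fun b => b⁻¹) + Multiset.replicate (n - P.roots.card) 0, by simp; omega⟩ : Sym ℂ n)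
  have hxP : ∏ i, (1 - Polynomial.C (x i) * Polynomial.X) = P := by
    have h1 : Finset.univ.val.map x =
        P.roots.map (fun b => b⁻¹) + Multiset.replicate (n - P.roots.card) 0 :=
      congrArg Subtype.val hx
    change (Finset.univ.val.map fun i => 1 - Polynomial.C (x i) * Polynomial.X).prod = P
    have h2 := congrArg (fun s => (s.map fun c : ℂ => 1 - Polynomial.C c * Polynomial.X).prod) h1
    simp only [Multiset.map_map, Multiset.map_add, Multiset.prod_add, Multiset.map_replicate,
      Polynomial.C_0, zero_mul, sub_zero, Multiset.prod_replicate, one_pow, mul_one] at h2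
    refine h2.trans (polynomial_eq_prod_one_sub hP0).symm
  let H : PowerSeries ℂ :=
    PowerSeries.mk fun r => MvPolynomial.eval x (MvPolynomial.hsymm (Fin n) ℂ r)
  have hHP : H * (P : PowerSeries ℂ) = 1 := by
    have hcoe : (P : PowerSeries ℂ) = ∏ i, (1 - PowerSeries.C (x i) * PowerSeries.X) := by
      rw [← hxP]
      rw [← Polynomial.coeToPowerSeries.ringHom_apply, map_prod]
      simp
    rw [hcoe, show H = _ from mk_eval_hsymm x, ← Finset.prod_mul_distrib]
    exact Finset.prod_eq_one fun i _ => powerSeries_geom_mul (x i)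
  have hAA : A * A⁻¹ = 1 := PowerSeries.mul_inv_cancel A hA0
  have hdiff : H - A = H * (A⁻¹ - (P : PowerSeries ℂ)) * A := by
    linear_combination (-H) * hAA + A * hHP
  have hdvd : PowerSeries.X ^ (n + 1) ∣ H - A := by
    rw [hdiff]
    refine Dvd.dvd.mul_right (Dvd.dvd.mul_left ?_ _) _
    rw [PowerSeries.X_pow_dvd_iff]
    intro k hk
    simp [P, PowerSeries.coeff_trunc, hk]
  refine ⟨x, fun r hr => ?_⟩
  have := PowerSeries.X_pow_dvd_iff.1 hdvd r (by omega)
  simpa [H, A, sub_eq_zero] using this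

end Prescribe

/-! ### Jacobi–Trudi determinants -/

section JacobiTrudi

/-- The vector `(f_i - i + π(i))_i` of indices in the expansion of a Jacobi–Trudi determinant. -/
def shiftedRow {p : ℕ} (f : Fin p → ℕ) (π : Perm (Fin p)) (i : Fin p) : ℤ :=
  (f i : ℤ) - (i : ℤ) + (π i : ℤ)

/-- The Jacobi–Trudi determinant `det (h_{f_i - i + j})`. -/
noncomputable def jacobiTrudi (σ : Type) [Fintype σ] [DecidableEq σ] {p : ℕ} (f : Fin p → ℕ) :
    MvPolynomial σ ℂ :=
  Matrix.det (Matrix.of fun i j : Fin p => hInt σ ((f i : ℤ) - (i : ℤ) + (j : ℤ)))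

theorem jacobiTrudi_eq_sum {σ : Type} [Fintype σ] [DecidableEq σ] {p : ℕ} (f : Fin p → ℕ) :
    jacobiTrudi σ f = ∑ π : Perm (Fin p), ((Equiv.Perm.sign π : ℤ) : ℂ) •
      ∏ i, hInt σ (shiftedRow f π i) := by
  rw [jacobiTrudi, ← Matrix.det_transpose, Matrix.det_apply]
  refine Finset.sum_congr rfl fun π _ => ?_
  rw [Int.cast_smul_eq_zsmul, Units.smul_def]
  rfl

theorem sum_shiftedRow {p : ℕ} (f : Fin p → ℕ) (π : Perm (Fin p)) :
    ∑ i, shiftedRow f π i = ∑ i, (f i : ℤ) := by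
  simp only [shiftedRow, Finset.sum_add_distrib, Finset.sum_sub_distrib]
  rw [Equiv.sum_comp π fun i => ((i : ℕ) : ℤ)]
  ring

/-- Expand the square of f_i + (π(i) - i): the cross terms are nonnegative by the rearrangement
inequality, and the squared displacements are not all zero. -/
theorem sum_sq_shiftedRow_gt {p : ℕ} {f : Fin p → ℕ} (hf : Antitone f) {π : Perm (Fin p)}
    (hπ : π ≠ 1) : ∑ i, (f i : ℤ) ^ 2 < ∑ i, shiftedRow f π i ^ 2 := by
  have h1 : ∑ i, (f i : ℤ) * ((i : ℕ) : ℤ) ≤ ∑ i, (f i : ℤ) * ((π i : ℕ) : ℤ) := by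
    refine Antivary.sum_mul_le_sum_mul_comp_perm (g := fun i : Fin p => ((i : ℕ) : ℤ)) ?_
    intro i j hij
    have : i < j := by simpa using hij
    exact Nat.cast_le.2 (hf this.le)
  have h2 : 0 < ∑ i, (((π i : ℕ) : ℤ) - ((i : ℕ) : ℤ)) ^ 2 := by
    obtain ⟨i, hi⟩ : ∃ i, π i ≠ i := by
      by_contra! h
      exact hπ (Equiv.ext h)
    refine Finset.sum_pos' (fun i _ => sq_nonneg _) ⟨i, Finset.mem_univ i, ?_⟩
    have : ((π i : ℕ) : ℤ) - ((i : ℕ) : ℤ) ≠ 0 := fun h => hi (Fin.ext (by omega))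
    positivity
  have h3 : ∑ i, shiftedRow f π i ^ 2 = ∑ i, (f i : ℤ) ^ 2 +
      2 * (∑ i, (f i : ℤ) * ((π i : ℕ) : ℤ) - ∑ i, (f i : ℤ) * ((i : ℕ) : ℤ)) +
      ∑ i, (((π i : ℕ) : ℤ) - ((i : ℕ) : ℤ)) ^ 2 := by
    rw [← Finset.sum_sub_distrib, Finset.mul_sum, ← Finset.sum_add_distrib,
      ← Finset.sum_add_distrib]
    refine Finset.sum_congr rfl fun i _ => ?_
    unfold shiftedRow
    ring
  linarith

/-- There is a point where a Jacobi–Trudi determinant with small first row does not vanish, but all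
complete homogeneous symmetric polynomials of large degree do. -/
theorem exists_eval_jacobiTrudi_ne_zero {n m p : ℕ} {f : Fin p → ℕ} (hf : Antitone f)
    (hsum : ∑ i, f i = n) (hm : 0 < m) (hfm : ∀ i, f i < m) :
    ∃ x : Fin n → ℂ, MvPolynomial.eval x (jacobiTrudi (Fin n) f) ≠ 0 ∧
      ∀ r, m ≤ r → r ≤ n → MvPolynomial.eval x (MvPolynomial.hsymm (Fin n) ℂ r) = 0 := by
  classical
  -- Specialize h_r to ε^(r²) for r < m and to 0 for m ≤ r ≤ n. The permutations in `G` are those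
  -- whose term survives, and `R` is the determinant as a polynomial in ε. The identity alone
  -- attains the least exponent, so `R` is nonzero.
  let G : Finset (Perm (Fin p)) :=
    Finset.univ.filter fun π => ∀ i, 0 ≤ shiftedRow f π i ∧ shiftedRow f π i < m
  let R : Polynomial ℂ := ∑ π ∈ G, Polynomial.C ((Equiv.Perm.sign π : ℤ) : ℂ) *
    Polynomial.X ^ (∑ i, shiftedRow f π i ^ 2).toNat
  have hone : (1 : Perm (Fin p)) ∈ G := by
    refine Finset.mem_filter.2 ⟨Finset.mem_univ _, fun i => ?_⟩
    have := hfm i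
    simp only [shiftedRow, Equiv.Perm.one_apply]
    omega
  have hone_row : ∀ i, shiftedRow f 1 i = f i := fun i => by simp [shiftedRow]
  have hR : R ≠ 0 := by
    have hcoeff : R.coeff (∑ i, (f i : ℤ) ^ 2).toNat = 1 := by
      simp only [R, Polynomial.finsetSum_coeff, Polynomial.coeff_C_mul_X_pow]
      rw [Finset.sum_eq_single 1]
      · simp [hone_row]
      · intro π _ hπ
        have h1 := sum_sq_shiftedRow_gt hf hπ
        have h2 : 0 ≤ ∑ i, (f i : ℤ) ^ 2 := Finset.sum_nonneg fun i _ => sq_nonneg _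
        exact if_neg (by omega)
      · exact fun h => absurd hone h
    intro h
    rw [h, Polynomial.coeff_zero] at hcoeff
    exact zero_ne_one hcoeff
  obtain ⟨ε, hε⟩ : ∃ ε, R.eval ε ≠ 0 := by
    by_contra! h
    exact hR (Polynomial.funext fun ε => by rw [h ε, Polynomial.eval_zero])
  obtain ⟨x, hx⟩ := exists_eval_hsymm_eq n (fun r => if r < m then ε ^ (r ^ 2) else 0) (by simp [hm])
  refine ⟨x, ?_, fun r hr hrn => by rw [hx r hrn, if_neg hr.not_gt]⟩
  have hterm : ∀ π : Perm (Fin p), MvPolynomial.eval x (∏ i, hInt (Fin n) (shiftedRow f π i)) =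
      if π ∈ G then ε ^ (∑ i, shiftedRow f π i ^ 2).toNat else 0 := by
    intro π
    rw [map_prod]
    by_cases hneg : ∀ i, 0 ≤ shiftedRow f π i
    · obtain ⟨r, hr⟩ : ∃ r : Fin p → ℕ, ∀ i, shiftedRow f π i = r i :=
        ⟨fun i => (shiftedRow f π i).toNat, fun i => (Int.toNat_of_nonneg (hneg i)).symm⟩
      have hrn : ∀ i, r i ≤ n := by
        intro i
        have h1 := sum_shiftedRow f π
        simp only [hr] at h1
        have h2 : ∑ i, r i = n := by rw [← hsum]; exact_mod_cast h1
        rw [← h2]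
        exact Finset.single_le_sum (fun _ _ => Nat.zero_le _) (Finset.mem_univ i)
      have hval : ∀ i, MvPolynomial.eval x (hInt (Fin n) (shiftedRow f π i)) =
          if r i < m then ε ^ (r i ^ 2) else 0 := fun i => by
        simp [hr, hInt, hx _ (hrn i)]
      rw [Finset.prod_congr rfl fun i _ => hval i]
      simp only [G, Finset.mem_filter, Finset.mem_univ, true_and, hr, Int.natCast_nonneg,
        Nat.cast_lt]
      split_ifs with h
      · rw [Finset.prod_congr rfl fun i _ => if_pos (h i), Finset.prod_pow_eq_pow_sum]
        congr 1
        have : (∑ i, (r i : ℤ) ^ 2) = ((∑ i, r i ^ 2 : ℕ) : ℤ) := by push_cast; rfl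
        rw [this, Int.toNat_natCast]
      · push Not at h
        obtain ⟨i, hi⟩ := h
        exact Finset.prod_eq_zero (Finset.mem_univ i) (if_neg hi.not_gt)
    · push Not at hneg
      obtain ⟨i, hi⟩ := hneg
      rw [if_neg fun h => hi.not_ge ((Finset.mem_filter.1 h).2 i).1]
      exact Finset.prod_eq_zero (Finset.mem_univ i) (by simp [hInt, hi.not_ge])
  have heval : MvPolynomial.eval x (jacobiTrudi (Fin n) f) = R.eval ε := by
    rw [jacobiTrudi_eq_sum, map_sum]
    simp only [MvPolynomial.smul_eval, hterm, R, Polynomial.eval_finsetSum, mul_ite, mul_zero,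
      Polynomial.eval_mul, Polynomial.eval_C, Polynomial.eval_pow, Polynomial.eval_X]
    rw [Finset.sum_ite_mem, Finset.univ_inter]
  rwa [heval]

end JacobiTrudi

/-! ### First rows of partitions in the stable range. -/

section StableRange

theorem schur_eq_jacobiTrudi (σ : Type) [Fintype σ] [DecidableEq σ] {n : ℕ} (lam : n.Partition) :
    schur σ lam = jacobiTrudi σ (rowLengths lam).get :=
  rfl

theorem sum_rowLengths {n : ℕ} (lam : n.Partition) : (rowLengths lam).sum = n := by
  conv_rhs => rw [← lam.parts_sum, ← Multiset.sort_eq lam.parts (· ≥ ·)]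
  rfl

theorem antitone_rowLengths_get {n : ℕ} (lam : n.Partition) : Antitone (rowLengths lam).get :=
  (List.sortedGE_iff_pairwise.2 (Multiset.pairwise_sort lam.parts (· ≥ ·))).antitone_get

/-- If `s_λ` lies in the span of `U_k`, then the first part of `λ` is at least `n - k`. -/
theorem exists_rowLengths_ge {n k : ℕ} (hk : k < n) (lam : n.Partition)
    (h : schur (Fin n) lam ∈ Submodule.span ℂ (stableSet n k)) :
    ∃ a T, rowLengths lam = a :: T ∧ n - k ≤ a := by
  have hsum : ∑ i, (rowLengths lam).get i = n := by
    rw [← List.sum_ofFn, List.ofFn_get, sum_rowLengths]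
  by_contra! hcon
  have hlt : ∀ i, (rowLengths lam).get i < n - k := by
    have hanti := antitone_rowLengths_get lam
    revert hanti hcon
    generalize rowLengths lam = L
    intro hcon hanti i
    cases L with
    | nil => exact i.elim0
    | cons a T => exact (hanti (Fin.zero_le i)).trans_lt (hcon a T rfl)
  -- At this point every element of U_k vanishes, having a factor h_{n-l} with n - l ≥ n - k,
  -- whereas s_λ does not.
  obtain ⟨x, hx, hx0⟩ := exists_eval_jacobiTrudi_ne_zero (antitone_rowLengths_get lam) hsum
    (Nat.sub_pos_of_lt hk) hlt
  refine hx ?_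
  rw [← schur_eq_jacobiTrudi]
  have hle : Submodule.span ℂ (stableSet n k) ≤
      LinearMap.ker (MvPolynomial.aeval (R := ℂ) x).toLinearMap := by
    rw [Submodule.span_le]
    rintro _ ⟨l, hl, mu, rfl⟩
    have h1 : hInt (Fin n) ((n : ℤ) - l) = MvPolynomial.hsymm (Fin n) ℂ (n - l) := by
      rw [hInt, if_pos (by omega)]
      congr 1
      omega
    have h2 := hx0 (n - l) (by omega) (by omega)
    rw [← MvPolynomial.aeval_eq_eval] at h2
    simp only [SetLike.mem_coe, LinearMap.mem_ker, AlgHom.toLinearMap_apply, map_mul, h1]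
    rw [show (MvPolynomial.aeval x) (MvPolynomial.hsymm (Fin n) ℂ (n - l)) = 0 from h2, zero_mul]
  exact hle h

end StableRange

/-! ### Multiplicities of irreducible representations -/

section Multiplicity

variable {n : ℕ}

/-- The orbit of a nonzero vector is finite and spans a nonzero subrepresentation, hence everything.
-/
theorem finiteDimensional_of_isIrreducible {G V : Type*} [Group G] [Finite G] [AddCommGroup V]
    [Module ℂ V] (ρ : Representation ℂ G V) (h : ρ.IsIrreducible) : FiniteDimensional ℂ V := by
  by_cases hV : ∃ v : V, v ≠ 0
  · obtain ⟨v, hv⟩ := hV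
    let W : Subrepresentation ρ :=
      { toSubmodule := Submodule.span ℂ (Set.range fun g => ρ g v)
        apply_mem_toSubmodule := by
          intro g w hw
          have hle : Submodule.span ℂ (Set.range fun g => ρ g v) ≤
              (Submodule.span ℂ (Set.range fun g => ρ g v)).comap (ρ g) := by
            rw [Submodule.span_le]
            rintro _ ⟨k, rfl⟩
            refine Submodule.subset_span ⟨g * k, ?_⟩
            simp
          exact hle hw }
    have hvW : v ∈ W.toSubmodule := Submodule.subset_span ⟨1, by simp⟩
    have hW : W = ⊤ := by
      refine (eq_bot_or_eq_top W).resolve_left fun hbot => hv ?_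
      rw [hbot] at hvW
      exact (Submodule.mem_bot ℂ).1 hvW
    have htop : Submodule.span ℂ (Set.range fun g => ρ g v) = ⊤ :=
      congrArg Subrepresentation.toSubmodule hW
    exact ⟨htop ▸ Submodule.fg_span (Set.finite_range _)⟩
  · push Not at hV
    have : Subsingleton V := ⟨fun a b => by rw [hV a, hV b]⟩
    infer_instance

theorem wordChar_conj {p : ℕ} (z : Fin p → ℤ) (g h : Perm (Fin n)) :
    wordChar n z (h * g * h⁻¹) = wordChar n z g := by
  unfold wordChar
  congr 1
  refine Finset.card_bij (fun u _ => u ∘ h) ?_ ?_ ?_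
  · intro u hu
    simp only [Finset.mem_filter, Finset.mem_univ, true_and] at hu ⊢
    refine ⟨fun i => ?_, funext fun a => ?_⟩
    · rw [← hu.1 i, Nat.cast_inj]
      exact exists_perm_comp_iff.1 ⟨h, rfl⟩ i
    · have := congrFun hu.2 (h a)
      simpa using this
  · intro u _ v _ huv
    exact h.surjective.injective_comp_right huv
  · intro u hu
    simp only [Finset.mem_filter, Finset.mem_univ, true_and] at hu
    refine ⟨u ∘ ⇑h⁻¹, ?_, ?_⟩
    · simp only [Finset.mem_filter, Finset.mem_univ, true_and]
      refine ⟨fun i => ?_, funext fun a => ?_⟩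
      · rw [← hu.1 i, Nat.cast_inj]
        exact exists_perm_comp_iff.1 ⟨h⁻¹, rfl⟩ i
      · have := congrFun hu.2 (h⁻¹ a)
        simpa using this
    · funext a
      simp

theorem wordChar_inv {p : ℕ} (z : Fin p → ℤ) (g : Perm (Fin n)) :
    wordChar n z g⁻¹ = wordChar n z g := by
  have h : ∀ u : Fin n → Fin p, u ∘ ⇑g⁻¹ = u ↔ u ∘ g = u := by
    intro u
    simp only [funext_iff, Function.comp_apply]
    constructor
    · intro hu a
      have := hu (g a)
      simpa using this.symm
    · intro hu a
      have := hu (g⁻¹ a)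
      simpa using this.symm
  simp only [wordChar, h]

theorem wordChar_of_neg {p : ℕ} {z : Fin p → ℤ} {i : Fin p} (hi : z i < 0) (g : Perm (Fin n)) :
    wordChar n z g = 0 := by
  unfold wordChar
  rw [Nat.cast_eq_zero, Finset.card_eq_zero, Finset.filter_eq_empty_iff]
  rintro u - ⟨h, -⟩
  have := h i
  omega

/-- The character of an irreducible representation as an alternating sum of permutation
characters. -/
theorem character_eq_sum_wordChar {V : Type*} [AddCommGroup V] [Module ℂ V]
    (ρ : Representation ℂ (Perm (Fin n)) V) {p : ℕ} {f : Fin p → ℕ}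
    (hf : ∑ i, f i = n) (h : frobeniusChar ρ = jacobiTrudi (Fin n) f) (g : Perm (Fin n)) :
    ρ.character g =
      ∑ π : Perm (Fin p), ((Equiv.Perm.sign π : ℤ) : ℂ) * wordChar n (shiftedRow f π) g := by
  have hzero := eq_zero_of_frobeniusFun (χ := ρ.character - fun g =>
      ∑ π : Perm (Fin p), ((Equiv.Perm.sign π : ℤ) : ℂ) * wordChar n (shiftedRow f π) g)
    (fun g h => by simp only [Pi.sub_apply, Representation.char_conj, wordChar_conj]) (by
      rw [frobeniusFun_sub, frobeniusFun_character, h, frobeniusFun_sum, jacobiTrudi_eq_sum,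
        sub_eq_zero]
      refine Finset.sum_congr rfl fun π _ => ?_
      rw [frobeniusFun_wordChar]
      rw [sum_shiftedRow, ← hf]
      push_cast
      rfl)
  exact sub_eq_zero.1 (congrFun hzero g)

/-- The multiplicity of the permutation representation on words in a representation. -/
noncomputable def wordPairing {p : ℕ} {W : Type*} [AddCommGroup W] [Module ℂ W]
    (z : Fin p → ℤ) (τ : Representation ℂ (Perm (Fin n)) W) : ℂ :=
  ((n.factorial : ℕ) : ℂ)⁻¹ * ∑ g, wordChar n z g * τ.character g

theorem irrMultiplicity_eq_sum {V W : Type*} [AddCommGroup V] [Module ℂ V] [AddCommGroup W]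
    [Module ℂ W] [FiniteDimensional ℂ V] [FiniteDimensional ℂ W]
    (ρ : Representation ℂ (Perm (Fin n)) V) (τ : Representation ℂ (Perm (Fin n)) W)
    {p : ℕ} {f : Fin p → ℕ} (hf : ∑ i, f i = n)
    (h : frobeniusChar ρ = jacobiTrudi (Fin n) f) :
    (irrMultiplicity ρ τ : ℂ) =
      ∑ π : Perm (Fin p), ((Equiv.Perm.sign π : ℤ) : ℂ) * wordPairing (shiftedRow f π) τ := by
  have hcard : Nat.card (Perm (Fin n)) = n.factorial := by
    rw [Nat.card_eq_fintype_card, Fintype.card_perm, Fintype.card_fin]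
  have : Invertible (Nat.card (Perm (Fin n)) : ℂ) :=
    invertibleOfNonzero (Nat.cast_ne_zero.2 Nat.card_pos.ne')
  rw [irrMultiplicity, ← Representation.card_inv_mul_sum_char_mul_char_eq_finrank, hcard]
  simp only [character_eq_sum_wordChar ρ hf h, wordChar_inv, wordPairing, Finset.mul_sum]
  rw [Finset.sum_comm]
  refine Finset.sum_congr rfl fun π _ => Finset.sum_congr rfl fun g _ => ?_
  ring

end Multiplicity

/-! ### Stability of multiplicities. -/

section StableMultiplicity

instance finiteDimensional_alpha (n : ℕ) (S : Finset ℕ) :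
    FiniteDimensional ℂ (MonoidAlgebra ℂ (Flag (RankSelected n S))) := by
  have : Finite (Flag (RankSelected n S)) :=
    Finite.of_injective (fun F : Flag (RankSelected n S) => (F : Set (RankSelected n S)))
      SetLike.coe_injective
  exact Module.Finite.equiv (MonoidAlgebra.coeffLinearEquiv ℂ).symm

instance finiteDimensional_chains (n : ℕ) (S : Finset ℕ) (j : ℕ) :
    FiniteDimensional ℂ (Chains (RankSelected n S) j) :=
  Module.Finite.of_basis (chainBasis _ j)

/-- The tail multiplicities sum to l = n - z_0 ≤ k, so n - l and n' - l are both at least 2M. Both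
pairings then become pairings of the same word character with isomorphic skewed representations. A
negative tail entry makes both of them zero. -/
theorem wordPairing_eq_of_stable {S : Finset ℕ} {M k q n n' : ℕ} (hM : ∀ s ∈ S, s ≤ M)
    (hn : 2 * M + k ≤ n) (hn' : 2 * M + k ≤ n') {z z' : Fin (q + 1) → ℤ}
    (hz : ∑ i, z i = n) (hz' : ∑ i, z' i = n') (htail : ∀ i : Fin q, z i.succ = z' i.succ)
    (hk : (n : ℤ) - k ≤ z 0) :
    wordPairing z (alphaRep n S) = wordPairing z' (alphaRep n' S) ∧
      wordPairing z (betaRep n S) = wordPairing z' (betaRep n' S) := by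
  by_cases hneg : ∀ i : Fin q, 0 ≤ z i.succ
  · obtain ⟨r, hr⟩ : ∃ r : Fin q → ℕ, ∀ i, z i.succ = r i :=
      ⟨fun i => (z i.succ).toNat, fun i => (Int.toNat_of_nonneg (hneg i)).symm⟩
    obtain ⟨l, hl⟩ : ∃ l, ∑ i, r i = l := ⟨_, rfl⟩
    have hl' : ∑ i, (r i : ℤ) = l := by exact_mod_cast hl
    rw [Fin.sum_univ_succ] at hz hz'
    simp only [← htail, hr, hl'] at hz hz'
    obtain ⟨m, rfl⟩ : ∃ m, n = l + m := ⟨n - l, by omega⟩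
    obtain ⟨m', rfl⟩ : ∃ m', n' = l + m' := ⟨n' - l, by omega⟩
    have hzc : z = Fin.cons (α := fun _ => ℤ) (m : ℤ) fun i => (r i : ℤ) := by
      funext i
      refine Fin.cases ?_ (fun j => ?_) i
      · rw [Fin.cons_zero]
        push_cast at hz
        omega
      · rw [Fin.cons_succ, hr]
    have hzc' : z' = Fin.cons (α := fun _ => ℤ) (m' : ℤ) fun i => (r i : ℤ) := by
      funext i
      refine Fin.cases ?_ (fun j => ?_) i
      · rw [Fin.cons_zero]
        push_cast at hz'
        omega
      · rw [Fin.cons_succ, ← htail, hr]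
    obtain ⟨⟨e⟩, ⟨f⟩⟩ := nonempty_skewRow_equiv_of_stable (l := l) (m := m) (m' := m') hM
      (by push_cast at hk hz; omega) (by push_cast at hk hz; omega)
    subst hzc hzc'
    constructor
    · rw [wordPairing, wordPairing, sum_wordChar_cons_mul_character _ r hl,
        sum_wordChar_cons_mul_character _ r hl, Representation.char_iso e]
    · rw [wordPairing, wordPairing, sum_wordChar_cons_mul_character _ r hl,
        sum_wordChar_cons_mul_character _ r hl, Representation.char_iso f]
  · push Not at hneg
    obtain ⟨i, hi⟩ := hneg
    have h1 : ∀ g, wordChar n z g = 0 := wordChar_of_neg hi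
    have h2 : ∀ g, wordChar n' z' g = 0 := wordChar_of_neg (htail i ▸ hi)
    simp [wordPairing, h1, h2]

theorem irrMultiplicity_eq_of_stable {S : Finset ℕ} {M k n n' : ℕ} (hM : ∀ s ∈ S, s ≤ M)
    (hM0 : 0 < M) (hn : 2 * M + k ≤ n) (hn' : 2 * M + k ≤ n') (lam : n.Partition)
    (lam' : n'.Partition) (htail : (rowLengths lam).tail = (rowLengths lam').tail)
    (hspan : schur (Fin n) lam ∈ Submodule.span ℂ (stableSet n k))
    {V V' : Type*} [AddCommGroup V] [Module ℂ V] [AddCommGroup V'] [Module ℂ V']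
    (ρ : Representation ℂ (Perm (Fin n)) V) (ρ' : Representation ℂ (Perm (Fin n')) V')
    (hρ : IsIrreducibleIndexedBy ρ lam) (hρ' : IsIrreducibleIndexedBy ρ' lam') :
    irrMultiplicity ρ (alphaRep n S) = irrMultiplicity ρ' (alphaRep n' S) ∧
      irrMultiplicity ρ (betaRep n S) = irrMultiplicity ρ' (betaRep n' S) := by
  have := finiteDimensional_of_isIrreducible ρ hρ.1
  have := finiteDimensional_of_isIrreducible ρ' hρ'.1
  obtain ⟨a, T, hL, ha⟩ := exists_rowLengths_ge (by omega) lam hspan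
  have hsum : (a :: T).sum = n := hL ▸ sum_rowLengths lam
  have hsum' := sum_rowLengths lam'
  obtain ⟨a', hL'⟩ : ∃ a', rowLengths lam' = a' :: T := by
    rw [hL, List.tail_cons] at htail
    cases h : rowLengths lam' with
    | nil =>
      rw [h, List.sum_nil] at hsum'
      omega
    | cons a' T' => exact ⟨a', by rw [htail, h, List.tail_cons]⟩
  rw [hL'] at hsum'
  have hch : frobeniusChar ρ = jacobiTrudi (Fin n) (a :: T).get := by
    rw [hρ.2, schur_eq_jacobiTrudi, hL]
  have hch' : frobeniusChar ρ' = jacobiTrudi (Fin n') (a' :: T).get := by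
    rw [hρ'.2, schur_eq_jacobiTrudi, hL']
  have hget : ∀ (L : List ℕ), ∑ i, L.get i = L.sum := fun L => by rw [← List.sum_ofFn, List.ofFn_get]
  have hf : ∑ i, (a :: T).get i = n := (hget _).trans hsum
  have hf' : ∑ i, (a' :: T).get i = n' := (hget _).trans hsum'
  -- The first index is a + π(0) ≥ a ≥ n - k, and the later indices involve only the common tail `T`
  -- and `π`.
  have key : ∀ π : Perm (Fin (T.length + 1)), _ := fun π =>
    wordPairing_eq_of_stable (q := T.length) hM hn hn' (z := shiftedRow (a :: T).get π)
      (z' := shiftedRow (a' :: T).get π)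
      (by rw [sum_shiftedRow]; exact_mod_cast hf) (by rw [sum_shiftedRow]; exact_mod_cast hf')
      (fun i => rfl) (by simp [shiftedRow]; omega)
  constructor
  · rw [← Nat.cast_inj (R := ℂ), irrMultiplicity_eq_sum ρ _ hf hch,
      irrMultiplicity_eq_sum ρ' _ hf' hch']
    exact Finset.sum_congr rfl fun π _ => congrArg _ (key π).1
  · rw [← Nat.cast_inj (R := ℂ), irrMultiplicity_eq_sum ρ _ hf hch,
      irrMultiplicity_eq_sum ρ' _ hf' hch']
    exact Finset.sum_congr rfl fun π _ => congrArg _ (key π).2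

end StableMultiplicity

theorem theorem5p3 (S : Finset ℕ) (hS : S.Nonempty) (k : ℕ) :
    (∀ n n' : ℕ, S ⊆ Finset.Icc 1 (n - 2) → S ⊆ Finset.Icc 1 (n' - 2) →
      2 * S.max' hS + k ≤ n → 2 * S.max' hS + k ≤ n' →
      ∀ (lam : n.Partition) (lam' : n'.Partition),
        (rowLengths lam).tail = (rowLengths lam').tail →
        schur (Fin n) lam ∈ Submodule.span ℂ (stableSet n k) →
        ∀ (V V' : Type*) [AddCommGroup V] [Module ℂ V] [AddCommGroup V'] [Module ℂ V']
          (ρ : Representation ℂ (Perm (Fin n)) V) (ρ' : Representation ℂ (Perm (Fin n')) V'),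
          IsIrreducibleIndexedBy ρ lam → IsIrreducibleIndexedBy ρ' lam' →
          irrMultiplicity ρ (alphaRep n S) = irrMultiplicity ρ' (alphaRep n' S) ∧
          irrMultiplicity ρ (betaRep n S) = irrMultiplicity ρ' (betaRep n' S)) ∧
    (∀ l ≤ k, ∀ m m' : ℕ,
      S ⊆ Finset.Icc 1 (l + m - 2) → S ⊆ Finset.Icc 1 (l + m' - 2) →
      2 * S.max' hS + k ≤ l + m → 2 * S.max' hS + k ≤ l + m' →
      Nonempty ((skewRow (alphaRep (l + m) S)).Equiv (skewRow (alphaRep (l + m') S))) ∧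
      Nonempty ((skewRow (betaRep (l + m) S)).Equiv (skewRow (betaRep (l + m') S)))) := by
  have hM : ∀ s ∈ S, s ≤ S.max' hS := fun s hs => S.le_max' s hs
  constructor
  · intro n n' hn _ h h' lam lam' htail hspan V V' _ _ _ _ ρ ρ' hρ hρ'
    have hM0 : 0 < S.max' hS := (Finset.mem_Icc.1 (hn (S.max'_mem hS))).1
    exact irrMultiplicity_eq_of_stable hM hM0 h h' lam lam' htail hspan ρ ρ' hρ hρ'
  · intro l hl m m' _ _ h h'
    -- From l ≤ k, both m and m' are at least 2 max S.
    exact nonempty_skewRow_equiv_of_stable hM (by omega) (by omega)
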